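/- Let $U\subseteq\mathbb R^m$ be open, $V:U\to\mathbb R$ smooth, and consider the Hamiltonian $H(x,p)=\tfrac12|p|^2+V(x)$ on $U\times\mathbb R^m$, i.e. $\dot x=p$, $\dot p=-\nabla V(x)$. Let $\bar\nabla V$ be a symmetric discrete gradient of $V$, defined and smooth on an open set $D\subseteq U\times U$ that contains the diagonal and is invariant under exchange of the two points: for $(x,y)\in D$, $$\bar\nabla V(x,y)\cdot(y-x)=V(y)-V(x),\qquad \bar\nabla V(x,y)=\bar\nabla V(y,x),$$ and $\bar\nabla V(y,z)\to\nabla V(x)$ as $(y,z)\to(x,x)$, for every $x\in U$. Write its expansion at $x\in U$ in powers of $\Delta x$ as $$\bar\nabla_\gamma V(x,x+\Delta x)=V_{,\gamma}+\tfrac12A_{\gamma\mu}\Delta x^\mu+\tfrac1{3!}B_{\gamma\mu\nu}\Delta x^\mu\Delta x^\nu+\tfrac1{4!}C_{\gamma\mu\nu\sigma}\Delta x^\mu\Delta x^\nu\Delta x^\sigma+O(|\Delta x|^4),$$ where repeated indices are summed from $1$ to $m$, commas denote partial derivatives, the coefficients depend on $x$, and $B_{\gamma\mu\nu}=B_{\gamma\nu\mu}$.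 The SLEX modification of the discrete gradient scheme is the implicit one-step method $(x_n,p_n)\mapsto(x_{n+1},p_{n+1})$ with step $h>0$, $$\delta_n^{-1}(x_{n+1}-x_n)=\tfrac12(p_n+p_{n+1}),\qquad(\delta_n^T)^{-1}(p_{n+1}-p_n)=-\bar\nabla V(x_n,x_{n+1}),$$ $$\delta_n=h\,\mathrm{tanc}\,\frac{h\Omega_n}{2},\qquad\Omega_n^2=V_{xx}\Big(\frac{x_n+x_{n+1}}2\Big),\qquad\mathrm{tanc}\,z=\frac{\tan z}{z},\quad\mathrm{tanc}\,0=1,$$ where $V_{xx}$ is the Hessian matrix of $V$ (since $\mathrm{tanc}$ is even, $\delta_n$ depends on $\Omega_n$ only through $\Omega_n^2$). The method is said to have order at least $r$ if, for every $(x_n,p_n)\in U\times\mathbb R^m$, these equations have for all sufficiently small $h>0$ a solution that tends to $(x_n,p_n)$ as $h\to0^+$, and every such solution differs from the exact solution at time $h$ of Hamilton's equations started at $(x_n,p_n)$ by $O(h^{r+1})$ as $h\to0^+$. Then: 1. the SLEX modification always has order at least $2$; 2. it has order at least $4$ if and only if $B_{\gamma\mu\nu}=V_{,\gamma\mu\nu}$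 on $U$ for all $\gamma,\mu,\nu\in\{1,\dots,m\}$. -/

import Mathlib

open Filter Topology Asymptotics
open scoped ContDiff Gradient RealInnerProductSpace

noncomputable section

namespace SLEX

/-- The configuration space (and the momentum space) `ℝᵐ` with its Euclidean structure. -/
abbrev Space (m : ℕ) : Type := EuclideanSpace ℝ (Fin m)

/-- The partial derivative `∂f/∂x^γ` at `x`. -/
def partialDeriv {m : ℕ} (γ : Fin m) (f : Space m → ℝ) (x : Space m) : ℝ :=
  fderiv ℝ f x (EuclideanSpace.single γ 1)

/-- The Hessian `V_{xx}(x)` as a linear operator: the derivative of the gradient field `∇V`. -/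
def hessian {m : ℕ} (V : Space m → ℝ) (x : Space m) : Space m →L[ℝ] Space m :=
  fderiv ℝ (∇ V) x

/-- `G` is a discrete gradient of `V` on the set `D` of pairs of points, where `D` contains the
diagonal of the domain `U` of `V`. For a globally defined one, `U` and `D` are everything. -/
structure IsDiscreteGradient {m : ℕ} (V : Space m → ℝ) (U : Set (Space m))
    (D : Set (Space m × Space m)) (G : Space m → Space m → Space m) : Prop where
  inner_eq : ∀ x y, (x, y) ∈ D → ⟪G x y, y - x⟫ = V y - V x
  tendsto : ∀ x ∈ U, Tendsto (fun z : Space m × Space m => G z.1 z.2) (𝓝 (x, x)) (𝓝 (∇ V x))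

/-- Symmetry of a discrete gradient on `D`. -/
def IsSymmetricOn {m : ℕ} (D : Set (Space m × Space m)) (G : Space m → Space m → Space m) : Prop :=
  ∀ x y, (x, y) ∈ D → (y, x) ∈ D ∧ G x y = G y x

/-- The expansion of `G x (x + d)` in powers of `d` through the third order: for all `x ∈ U`,
`G_γ = V,_γ + (1/2) A_{γμ} d^μ + (1/3!) B_{γμν} d^μ d^ν + (1/4!) C_{γμνσ} d^μ d^ν d^σ + O(|d|⁴)`,
with coefficients depending on `x`. The coefficients `B` of the quadratic form are symmetric
in the last two indices, which makes them unique. -/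
structure HasExpansion {m : ℕ} (V : Space m → ℝ) (U : Set (Space m))
    (G : Space m → Space m → Space m)
    (A : Space m → Fin m → Fin m → ℝ)
    (B : Space m → Fin m → Fin m → Fin m → ℝ)
    (C : Space m → Fin m → Fin m → Fin m → Fin m → ℝ) : Prop where
  symm : ∀ x ∈ U, ∀ γ μ ν, B x γ μ ν = B x γ ν μ
  isBigO : ∀ x ∈ U, ∀ γ,
    (fun d : Space m => G x (x + d) γ -
      (partialDeriv γ V x
        + 1 / 2 * ∑ μ, A x γ μ * d μ
        + 1 / 6 * ∑ μ, ∑ ν, B x γ μ ν * d μ * d ν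
        + 1 / 24 * ∑ μ, ∑ ν, ∑ σ, C x γ μ ν σ * d μ * d ν * d σ))
    =O[𝓝 0] fun d : Space m => ‖d‖ ^ 4

/-- `cos M` as a function of `S = M²`: the everywhere convergent series `∑ (-1)ᵏ Sᵏ / (2k)!`. -/
def cosOfSq {R : Type*} [NormedRing R] [NormedAlgebra ℝ R] (S : R) : R :=
  ∑' k : ℕ, ((-1 : ℝ) ^ k / ((2 * k).factorial : ℝ)) • S ^ k

/-- `sinc M = M⁻¹ sin M` as a function of `S = M²`: the everywhere convergent series
`∑ (-1)ᵏ Sᵏ / (2k+1)!`. -/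
def sincOfSq {R : Type*} [NormedRing R] [NormedAlgebra ℝ R] (S : R) : R :=
  ∑' k : ℕ, ((-1 : ℝ) ^ k / ((2 * k + 1).factorial : ℝ)) • S ^ k

/-- `tanc M = M⁻¹ tan M = (sinc M) (cos M)⁻¹` as a function of `S = M²`. As `tanc` is even, the
value depends on `M` only through `M²`, and no square root of `S` (which can be non-real) has to be
chosen. -/
def tancOfSq {R : Type*} [NormedRing R] [NormedAlgebra ℝ R] (S : R) : R :=
  sincOfSq S * Ring.inverse (cosOfSq S)

/-- On complex scalars `tancOfSq (z²)` is `tan z / z`, and `1` at `z = 0`. -/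
theorem tancOfSq_sq (z : ℂ) : tancOfSq (z ^ 2) = if z = 0 then 1 else Complex.tan z / z := by
  have hc : cosOfSq (z ^ 2) = Complex.cos z := by
    rw [← (Complex.hasSum_cos z).tsum_eq]
    refine tsum_congr fun k => ?_
    rw [Complex.real_smul, ← pow_mul]
    push_cast
    ring
  have hs : z * sincOfSq (z ^ 2) = Complex.sin z := by
    rw [← (Complex.hasSum_sin z).tsum_eq, sincOfSq, ← tsum_mul_left]
    refine tsum_congr fun k => ?_
    rw [Complex.real_smul, ← pow_mul]
    push_cast
    ring
  split_ifs with hz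
  · have h0 : sincOfSq ((0 : ℂ) ^ 2) = 1 := by
      rw [sincOfSq, tsum_eq_single 0]
      · simp
      · intro k hk
        simp [hk]
    rw [tancOfSq, hc, hz, h0]
    simp
  · rw [tancOfSq, hc, Ring.inverse_eq_inv', Complex.tan_eq_sin_div_cos, ← hs]
    field_simp

/-- The matrix `δ = h tanc (h Ω / 2)` with `Ω² = V_{xx}(x̄)`, as a linear operator. -/
def delta {m : ℕ} (V : Space m → ℝ) (h : ℝ) (xbar : Space m) : Space m →L[ℝ] Space m :=
  h • tancOfSq ((h / 2) ^ 2 • hessian V xbar)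

/-- `(x', p')` is a result of one step of length `h` from `(x, p)` of the SLEX modification of the
discrete gradient scheme for `H = p²/2 + V(x)`: `δ` is invertible and
`δ⁻¹ (x' - x) = (p + p') / 2`, `(δᵀ)⁻¹ (p' - p) = - G x x'`, where `δ` is evaluated at the midpoint
`(x + x') / 2`. -/
def IsStep {m : ℕ} (V : Space m → ℝ) (G : Space m → Space m → Space m)
    (h : ℝ) (x p x' p' : Space m) : Prop :=
  IsUnit (delta V h (midpoint ℝ x x')) ∧
  Ring.inverse (delta V h (midpoint ℝ x x')) (x' - x) = (1 / 2 : ℝ) • (p + p') ∧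
  Ring.inverse (ContinuousLinearMap.adjoint (delta V h (midpoint ℝ x x'))) (p' - p) = - G x x'

/-- `(X h, P h)` is the numerical solution after one step of length `h` from `(x, p)`, for all small
`h > 0`: it satisfies the implicit equations of the scheme and tends to `(x, p)` as `h → 0`. -/
def IsNumericalSolution {m : ℕ} (V : Space m → ℝ) (G : Space m → Space m → Space m)
    (x p : Space m) (X P : ℝ → Space m) : Prop :=
  Tendsto X (𝓝[>] 0) (𝓝 x) ∧ Tendsto P (𝓝[>] 0) (𝓝 p) ∧
  ∀ᶠ h in 𝓝[>] (0 : ℝ), IsStep V G h x p (X h) (P h)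

/-- `(ξ, η)` solves Hamilton's equations `ẋ = p`, `ṗ = -∇V(x)` near time `0`, starting from
`(x, p)`. -/
def IsExactSolution {m : ℕ} (V : Space m → ℝ) (x p : Space m) (ξ η : ℝ → Space m) : Prop :=
  ξ 0 = x ∧ η 0 = p ∧
  ∀ᶠ t in 𝓝 (0 : ℝ), HasDerivAt ξ (η t) t ∧ HasDerivAt η (-(∇ V (ξ t))) t

/-- The SLEX scheme has order at least `r` on the domain `U`: from every `(x, p)` with `x ∈ U` the
implicit equations can be solved for all small `h > 0`, and the numerical solution differs from the
exact one by `O(h^{r+1})` after one step of length `h → 0`. -/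
def HasOrderAtLeast {m : ℕ} (V : Space m → ℝ) (U : Set (Space m))
    (G : Space m → Space m → Space m) (r : ℕ) : Prop :=
  ∀ x ∈ U, ∀ p : Space m,
    (∃ X P : ℝ → Space m, IsNumericalSolution V G x p X P) ∧
    ∀ X P ξ η : ℝ → Space m, IsNumericalSolution V G x p X P → IsExactSolution V x p ξ η →
      (fun h => X h - ξ h) =O[𝓝[>] 0] (fun h : ℝ => h ^ (r + 1)) ∧
      (fun h => P h - η h) =O[𝓝[>] 0] (fun h : ℝ => h ^ (r + 1))

end SLEX

end

/-!
The order of the scheme is read off from its defect: what remains when the exact solution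
`γ = (ξ, η)` of Hamilton's equations is inserted into the implicit equations. In phase space one
step reads `z' = z + h Φ(h, z, z')` with a smooth increment function `Φ` (`stepMap`), so the equation
is solvable for small `h` by the implicit function theorem, and, `Φ` being locally Lipschitz, the
error and the defect after one step are of the same order (`error_isBigO_iff_defect_isBigO`,
`hasOrderAtLeast_iff`).

The method is symmetric: `Φ(-h, z', z) = Φ(h, z, z')`, because the discrete gradient is symmetric and
`tanc` is even. Hence the defect over the time interval `[c - s, c + s]`, for a fixed solution,
is a smooth function of `(s, c)` which is odd in `s`. If its leading term at every `c` is `s³ K(c)`,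
then the next term is of order `s⁵`, uniformly in `c` (`isBigO_of_odd`), and `s = c = h / 2` gives the
defect of one step. So the order is always at least two, and it is at least four if and only
if `K` vanishes.

To find `K` it suffices to expand around the centre of the interval (`defect_sub_isLittleO`). With
`S = V_{xx}(x)` and `tanc(s√S) = 1 + s² S / 3 + o(s²)`, all terms of order `s³` in the position
component cancel, and so do all terms with `S` in the momentum component. What is left is
`Q₋(p, p) - V'''(p, p) / 3`, where `Q₋(p, p)` is the second derivative of the discrete gradient `G` at
`(x, x)` in the direction `(-p, p)`. As `G` is symmetric and equals `∇V` on the diagonal, the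
parallelogram identity gives `Q₋(p, p) = 4 ∂₂²G(p, p) - V'''(p, p)`, and `∂₂²G = B / 3`. Therefore
`K = 4 / 3 (B - V''')(p, p)` (`defectCoeff_apply`), and polarization in `p` finishes the proof.
-/

noncomputable section

namespace SLEX

/-! ### Asymptotic expansions, uniform in a parameter -/

section Expansions

variable {E : Type*} [NormedAddCommGroup E] [NormedSpace ℝ E]

theorem norm_le_of_hasDerivAt {f f' : ℝ → E} {C s : ℝ} {k : ℕ} (hC : 0 ≤ C)
    (hd : ∀ u, |u| ≤ |s| → HasDerivAt f (f' u) u) (hb : ∀ u, |u| ≤ |s| → ‖f' u‖ ≤ C * |u| ^ k)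
    (h0 : f 0 = 0) : ‖f s‖ ≤ C * |s| ^ (k + 1) := by
  have key := Convex.norm_image_sub_le_of_norm_hasDerivWithin_le (f := f) (f' := f')
    (C := C * |s| ^ k) (s := Metric.closedBall 0 |s|) (x := 0) (y := s)
    (fun u hu => (hd u (by simpa using hu)).hasDerivWithinAt)
    (fun u hu => (hb u (by simpa using hu)).trans (by
      have : |u| ≤ |s| := by simpa using hu
      gcongr)) (convex_closedBall _ _) (by simp) (by simp)
  simpa [h0, pow_succ, mul_assoc] using key

theorem isLittleO_pow_succ_of_hasDerivAt {f f' : ℝ → E} {k : ℕ}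
    (hd : ∀ᶠ s in 𝓝 (0 : ℝ), HasDerivAt f (f' s) s)
    (hf' : f' =o[𝓝 0] fun s : ℝ => s ^ k) (h0 : f 0 = 0) :
    f =o[𝓝 0] fun s : ℝ => s ^ (k + 1) := by
  rw [isLittleO_iff] at hf' ⊢
  intro C hC
  obtain ⟨ε, hε, hball⟩ := Metric.eventually_nhds_iff.1 (hd.and (hf' hC))
  refine Metric.eventually_nhds_iff.2 ⟨ε, hε, fun s hs => ?_⟩
  have hs' : |s| < ε := by simpa using hs
  have hu : ∀ u : ℝ, |u| ≤ |s| → dist u 0 < ε := fun u hu => by simpa using hu.trans_lt hs'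
  simpa using norm_le_of_hasDerivAt hC.le (fun u h => (hball (hu u h)).1)
    (fun u h => by simpa using (hball (hu u h)).2) h0

/-- Integration of an asymptotic bound in the first variable, uniformly in the second one. -/
theorem isBigO_pow_succ_of_hasDerivAt {f f' : ℝ × ℝ → E} {k : ℕ}
    (hd : ∀ᶠ z in 𝓝 (0 : ℝ × ℝ), HasDerivAt (fun s => f (s, z.2)) (f' z) z.1)
    (hf' : f' =O[𝓝 0] fun z : ℝ × ℝ => z.1 ^ k) (h0 : ∀ᶠ c in 𝓝 (0 : ℝ), f (0, c) = 0) :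
    f =O[𝓝 0] fun z : ℝ × ℝ => z.1 ^ (k + 1) := by
  obtain ⟨C, hC, hf'⟩ := hf'.exists_pos
  refine IsBigO.of_bound C ?_
  have h0' : ∀ᶠ z in 𝓝 (0 : ℝ × ℝ), f (0, z.2) = 0 :=
    (continuous_snd.tendsto (0 : ℝ × ℝ)).eventually h0
  obtain ⟨ε, hε, hball⟩ := Metric.eventually_nhds_iff.1 (hd.and (hf'.bound.and h0'))
  refine Metric.eventually_nhds_iff.2 ⟨ε, hε, fun {z} hz => ?_⟩
  have hz' : |z.1| < ε ∧ |z.2| < ε := by simpa [Prod.norm_def] using hz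
  have hu : ∀ u : ℝ, |u| ≤ |z.1| → dist (u, z.2) (0 : ℝ × ℝ) < ε := fun u hu => by
    simpa [Prod.dist_eq] using ⟨hu.trans_lt hz'.1, hz'.2⟩
  simpa using norm_le_of_hasDerivAt (f := fun s => f (s, z.2)) (f' := fun s => f' (s, z.2)) hC.le
    (fun u h => (hball (hu u h)).1) (fun u h => by simpa using (hball (hu u h)).2.1)
    (hball hz).2.2

/-- Taylor expansion in the first variable, uniform in the second one. -/
theorem exists_taylor_fst (n : ℕ) : ∀ {f : ℝ × ℝ → E}, ContDiffAt ℝ ∞ f 0 →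
    ∃ a : ℕ → ℝ → E, (∀ k, ContinuousAt (a k) 0) ∧
      (fun z : ℝ × ℝ => f z - ∑ k ∈ Finset.range n, z.1 ^ k • a k z.2)
        =O[𝓝 0] fun z : ℝ × ℝ => z.1 ^ n := by
  induction n with
  | zero =>
    intro f hf
    refine ⟨fun _ _ => 0, fun _ => continuousAt_const, ?_⟩
    simpa using (hf.continuousAt.tendsto).isBigO_one ℝ
  | succ n ih =>
    intro f hf
    have hf' : ContDiffAt ℝ ∞ (fun z => fderiv ℝ f z (1, 0)) 0 :=
      (hf.fderiv_right (m := ∞) (by simp)).clm_apply contDiffAt_const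
    obtain ⟨b, hb, hO⟩ := ih hf'
    -- The expansion of the derivative in the first variable is integrated term by term.
    refine ⟨fun k => k.casesOn (fun c => f (0, c)) fun j c => ((j : ℝ) + 1)⁻¹ • b j c, ?_, ?_⟩
    · rintro (_ | j)
      · have h : Continuous fun c : ℝ => ((0 : ℝ), c) := by fun_prop
        exact hf.continuousAt.comp_of_eq h.continuousAt rfl
      · exact (hb j).const_smul _
    · refine isBigO_pow_succ_of_hasDerivAt (f' := fun z : ℝ × ℝ => fderiv ℝ f z (1, 0) -
        ∑ k ∈ Finset.range n, z.1 ^ k • b k z.2) ?_ hO (Eventually.of_forall fun c => ?_)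
      · have h1 : ∀ᶠ z in 𝓝 (0 : ℝ × ℝ), ContDiffAt ℝ 1 f z :=
          (hf.of_le (by simp)).eventually (by simp)
        filter_upwards [h1] with z hz
        refine HasDerivAt.sub ?_ ?_
        · have h2 : HasDerivAt (fun s : ℝ => (s, z.2)) ((1 : ℝ), (0 : ℝ)) z.1 :=
            (hasDerivAt_id z.1).prodMk (hasDerivAt_const _ _)
          exact (hz.differentiableAt (by simp)).hasFDerivAt.comp_hasDerivAt z.1 h2
        · simp only [Finset.sum_range_succ', pow_zero]
          refine HasDerivAt.add_const _ ?_
          refine HasDerivAt.fun_sum fun k _ => ?_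
          have h3 := (hasDerivAt_pow (k + 1) z.1).smul_const (((k : ℝ) + 1)⁻¹ • b k z.2)
          convert h3 using 1
          rw [smul_smul]
          congr 1
          push_cast
          have : (k : ℝ) + 1 ≠ 0 := by positivity
          field_simp
      · simp [Finset.sum_range_succ']

theorem eq_zero_of_pow_smul_isLittleO {a : E} {k : ℕ}
    (h : (fun s : ℝ => s ^ k • a) =o[𝓝[>] 0] fun s : ℝ => s ^ k) : a = 0 := by
  have h1 := (isLittleO_iff_tendsto' (f := fun s : ℝ => ‖s ^ k • a‖) (g := fun s : ℝ => s ^ k)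
    ?_).1 h.norm_left
  · refine norm_eq_zero.1 (tendsto_nhds_unique (tendsto_const_nhds.congr' ?_) h1)
    filter_upwards [self_mem_nhdsWithin] with s hs
    have hs : 0 < s := hs
    rw [norm_smul, Real.norm_of_nonneg (by positivity)]
    field_simp
  · filter_upwards [self_mem_nhdsWithin] with s hs h0
    have hs : 0 < s := hs
    exact absurd h0 (by positivity)

/-- Uniqueness of the coefficients of `s` and of `s ^ k` in an expansion up to `o(s ^ k)`. -/
theorem eq_zero_of_smul_add_pow_smul_isLittleO {a b : E} {k : ℕ} (hk : 1 < k)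
    (h : (fun s : ℝ => s • a + s ^ k • b) =o[𝓝 0] fun s : ℝ => s ^ k) : a = 0 ∧ b = 0 := by
  have ha : a = 0 := by
    have h1 : (fun s : ℝ => s ^ k • b) =o[𝓝 0] fun s : ℝ => s ^ 1 := by
      refine IsBigO.trans_isLittleO (g := fun s : ℝ => s ^ k)
        (IsBigO.of_bound ‖b‖ (Eventually.of_forall fun s => ?_)) (isLittleO_pow_pow hk)
      rw [norm_smul, mul_comm]
    have h2 := (h.trans (isLittleO_pow_pow hk)).sub h1
    refine eq_zero_of_pow_smul_isLittleO (k := 1)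
      ((h2.congr_left fun s => ?_).mono nhdsWithin_le_nhds)
    module
  subst ha
  exact ⟨rfl, eq_zero_of_pow_smul_isLittleO
    ((h.congr_left fun s => by module).mono nhdsWithin_le_nhds)⟩

/-- A function that is odd in `s` and whose leading term at each `c` is `s³ K(c)` has no
term of order `s⁴`, uniformly in `c`. -/
theorem isBigO_of_odd {f : ℝ × ℝ → E} {K : ℝ → E} (hf : ContDiffAt ℝ ∞ f 0)
    (hodd : ∀ᶠ z in 𝓝 (0 : ℝ × ℝ), f (-z.1, z.2) = -f z)
    (hK : ∀ᶠ c in 𝓝 (0 : ℝ), (fun s : ℝ => f (s, c) - s ^ 3 • K c) =o[𝓝 0] fun s : ℝ => s ^ 3) :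
    (fun z : ℝ × ℝ => f z - z.1 ^ 3 • K z.2) =O[𝓝 0] (fun z : ℝ × ℝ => z.1 ^ 5) ∧
      ContinuousAt K 0 := by
  obtain ⟨a, ha, hO⟩ := exists_taylor_fst 5 hf
  have hrefl : Tendsto (fun z : ℝ × ℝ => (-z.1, z.2)) (𝓝 0) (𝓝 0) := by
    have : Continuous fun z : ℝ × ℝ => (-z.1, z.2) := by fun_prop
    exact this.tendsto' 0 0 (by simp)
  -- The odd part of the expansion.
  have h1 : (fun z : ℝ × ℝ => f z - (z.1 • a 1 z.2 + z.1 ^ 3 • a 3 z.2))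
      =O[𝓝 0] fun z : ℝ × ℝ => z.1 ^ 5 := by
    have h2 : (fun z : ℝ × ℝ => f (-z.1, z.2) -
        ∑ k ∈ Finset.range 5, (-z.1) ^ k • a k z.2) =O[𝓝 0] fun z : ℝ × ℝ => z.1 ^ 5 := by
      refine (hO.comp_tendsto hrefl).trans (IsBigO.of_bound 1 (Eventually.of_forall fun z => ?_))
      simp
    refine ((hO.sub h2).const_smul_left (1 / 2 : ℝ)).congr' ?_ EventuallyEq.rfl
    filter_upwards [hodd] with z hz
    simp only [Finset.sum_range_succ, Finset.sum_range_zero, hz, Pi.smul_apply]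
    module
  have hcoef : ∀ᶠ c in 𝓝 (0 : ℝ), a 1 c = 0 ∧ a 3 c = K c := by
    obtain ⟨C, hC⟩ := h1.bound
    rw [← Prod.mk_zero_zero, nhds_prod_eq] at hC
    filter_upwards [(eventually_swap_iff.1 hC).curry, hK] with c hc hKc
    have h4 : (fun s : ℝ => f (s, c) - (s • a 1 c + s ^ 3 • a 3 c)) =o[𝓝 0] fun s : ℝ => s ^ 3 :=
      (IsBigO.of_bound C (g := fun s : ℝ => s ^ 5) hc).trans_isLittleO (isLittleO_pow_pow (by norm_num))
    have h5 : (fun s : ℝ => s • a 1 c + s ^ 3 • (a 3 c - K c)) =o[𝓝 0] fun s : ℝ => s ^ 3 :=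
      (hKc.sub h4).congr_left fun s => by module
    obtain ⟨h6, h7⟩ := eq_zero_of_smul_add_pow_smul_isLittleO (by norm_num) h5
    exact ⟨h6, sub_eq_zero.1 h7⟩
  refine ⟨h1.congr' ?_ EventuallyEq.rfl, (ha 3).congr (hcoef.mono fun c hc => hc.2)⟩
  filter_upwards [(continuous_snd.tendsto (0 : ℝ × ℝ)).eventually hcoef] with z hz
  rw [hz.1, hz.2]
  module

end Expansions

/-! ### Second order expansions along curves -/

section SecondOrder

variable {E F : Type*} [NormedAddCommGroup E] [NormedSpace ℝ E] [NormedAddCommGroup F]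
  [NormedSpace ℝ F]

theorem sub_taylor_two_isLittleO {f f' : ℝ → E} {a : E}
    (hf : ∀ᶠ s in 𝓝 (0 : ℝ), HasDerivAt f (f' s) s) (hf' : HasDerivAt f' a 0) :
    (fun s => f s - (f 0 + s • f' 0 + (s ^ 2 / 2) • a)) =o[𝓝 0] fun s : ℝ => s ^ 2 := by
  refine isLittleO_pow_succ_of_hasDerivAt (f' := fun s => f' s - (f' 0 + s • a)) ?_ ?_ (by simp)
  · filter_upwards [hf] with s hs
    refine hs.sub ?_
    have h1 : HasDerivAt (fun s : ℝ => f 0 + s • f' 0) (f' 0) s := by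
      simpa using ((hasDerivAt_id s).smul_const (f' 0)).const_add (f 0)
    refine h1.add ?_
    have h2 : HasDerivAt (fun s : ℝ => s ^ 2 / 2) s s := by
      have := (hasDerivAt_pow 2 s).div_const 2
      simpa using this
    exact h2.smul_const a
  · have := hf'.isLittleO
    simp only [sub_zero, pow_one] at this ⊢
    exact this.congr_left fun s => by abel

/-- The even part of the second order Taylor expansion. -/
theorem even_part_sub_taylor_two_isLittleO {f f' : ℝ → E} {a : E}
    (hf : ∀ᶠ s in 𝓝 (0 : ℝ), HasDerivAt f (f' s) s) (hf' : HasDerivAt f' a 0) :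
    (fun s => (1 / 2 : ℝ) • (f (-s) + f s) - (f 0 + (s ^ 2 / 2) • a))
      =o[𝓝 0] fun s : ℝ => s ^ 2 := by
  have h := sub_taylor_two_isLittleO hf hf'
  have hneg : Tendsto (fun s : ℝ => -s) (𝓝 0) (𝓝 0) := by
    simpa using (continuous_neg (G := ℝ)).tendsto 0
  have h' := (h.comp_tendsto hneg).congr_right (g₂ := fun s : ℝ => s ^ 2) fun s => by simp
  refine ((h.add h').const_smul_left (1 / 2 : ℝ)).congr_left fun s => ?_
  simp only [Pi.smul_apply, Function.comp_apply, neg_sq]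
  module

/-- The first and second derivative of a function along a curve. -/
theorem hasDerivAt_comp_twice {Φ : F → E} {γ γ' : ℝ → F} {w a : F} (hΦ : ContDiffAt ℝ 2 Φ w)
    (hγ : ∀ᶠ s in 𝓝 (0 : ℝ), HasDerivAt γ (γ' s) s) (hγ' : HasDerivAt γ' a 0) (h0 : γ 0 = w) :
    (∀ᶠ s in 𝓝 (0 : ℝ), HasDerivAt (fun s => Φ (γ s)) (fderiv ℝ Φ (γ s) (γ' s)) s) ∧
      HasDerivAt (fun s => fderiv ℝ Φ (γ s) (γ' s))
        (fderiv ℝ (fderiv ℝ Φ) w (γ' 0) (γ' 0) + fderiv ℝ Φ w a) 0 := by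
  subst h0
  constructor
  · have h1 : ∀ᶠ s in 𝓝 (0 : ℝ), ContDiffAt ℝ 2 Φ (γ s) :=
      hγ.self_of_nhds.continuousAt.tendsto.eventually (hΦ.eventually (by simp))
    filter_upwards [hγ, h1] with s hs hs'
    exact (hs'.differentiableAt (by simp)).hasFDerivAt.comp_hasDerivAt s hs
  · have h1 : DifferentiableAt ℝ (fderiv ℝ Φ) (γ 0) :=
      (hΦ.fderiv_right (m := 1) (by norm_num)).differentiableAt (by simp)
    exact (h1.hasFDerivAt.comp_hasDerivAt (0 : ℝ) hγ.self_of_nhds).clm_apply hγ'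

theorem hasDerivAt_line (x v : F) (s : ℝ) : HasDerivAt (fun s : ℝ => x + s • v) v s := by
  simpa using ((hasDerivAt_id s).smul_const v).const_add x

theorem sub_taylor_two_line_isLittleO {Φ : F → E} {x : F} (hΦ : ContDiffAt ℝ 2 Φ x) (v : F) :
    (fun s : ℝ => Φ (x + s • v) -
      (Φ x + s • fderiv ℝ Φ x v + (s ^ 2 / 2) • fderiv ℝ (fderiv ℝ Φ) x v v))
        =o[𝓝 0] fun s : ℝ => s ^ 2 := by
  have h := hasDerivAt_comp_twice (γ := fun s : ℝ => x + s • v) (γ' := fun _ => v) (a := 0) hΦ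
    (Eventually.of_forall fun s => hasDerivAt_line x v s) (hasDerivAt_const _ _) (by simp)
  simpa using sub_taylor_two_isLittleO h.1 h.2

/-- Functions which agree along two lines have the same derivatives of order one and two
in the directions of these lines. -/
theorem fderiv_eq_of_eventuallyEq_line {F' : Type*} [NormedAddCommGroup F'] [NormedSpace ℝ F']
    {Φ : F → E} {Ψ : F' → E} {x v : F} {y w : F'} (hΦ : ContDiffAt ℝ 2 Φ x)
    (hΨ : ContDiffAt ℝ 2 Ψ y)
    (h : ∀ᶠ s in 𝓝 (0 : ℝ), Φ (x + s • v) = Ψ (y + s • w)) :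
    fderiv ℝ Φ x v = fderiv ℝ Ψ y w ∧
      fderiv ℝ (fderiv ℝ Φ) x v v = fderiv ℝ (fderiv ℝ Ψ) y w w := by
  have h1 := hasDerivAt_comp_twice (γ := fun s : ℝ => x + s • v) (γ' := fun _ => v) (a := 0) hΦ
    (Eventually.of_forall fun s => hasDerivAt_line x v s) (hasDerivAt_const _ _) (by simp)
  have h2 := hasDerivAt_comp_twice (γ := fun s : ℝ => y + s • w) (γ' := fun _ => w) (a := 0) hΨ
    (Eventually.of_forall fun s => hasDerivAt_line y w s) (hasDerivAt_const _ _) (by simp)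
  have h3 : (fun s : ℝ => fderiv ℝ Φ (x + s • v) v) =ᶠ[𝓝 0]
      fun s => fderiv ℝ Ψ (y + s • w) w := by
    filter_upwards [h1.1, h2.1, h.eventually_nhds] with s hs1 hs2 hs
    exact hs1.unique (hs2.congr_of_eventuallyEq hs)
  refine ⟨by simpa using h3.self_of_nhds, ?_⟩
  simpa using h1.2.unique (h2.2.congr_of_eventuallyEq h3)

end SecondOrder

/-! ### The matrix function `tanc` -/

section Tanc

variable {R : Type*} [NormedRing R] [NormedAlgebra ℝ R]

theorem cosOfSq_zero : cosOfSq (0 : R) = 1 := by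
  rw [cosOfSq, tsum_eq_single 0 (fun k hk => by simp [hk])]
  simp

theorem sincOfSq_zero : sincOfSq (0 : R) = 1 := by
  rw [sincOfSq, tsum_eq_single 0 (fun k hk => by simp [hk])]
  simp

theorem tancOfSq_zero : tancOfSq (0 : R) = 1 := by
  simp [tancOfSq, cosOfSq_zero, sincOfSq_zero]

/-- A power series whose coefficients decay at least like `1 / k!` is entire. -/
theorem radius_ofScalars_eq_top {c : ℕ → ℝ}
    (hc : ∀ k, |c (k + 1)| * ((k : ℝ) + 1) ≤ |c k|) (h0 : ∀ k, c k ≠ 0) :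
    (FormalMultilinearSeries.ofScalars R c).radius = ⊤ := by
  refine FormalMultilinearSeries.ofScalars_radius_eq_top_of_tendsto _ c
    (Eventually.of_forall h0) ?_
  refine squeeze_zero (fun k => by positivity) (fun k => ?_)
    (tendsto_one_div_add_atTop_nhds_zero_nat (𝕜 := ℝ))
  rw [Real.norm_eq_abs, Real.norm_eq_abs, div_le_div_iff₀ (abs_pos.2 (h0 k)) (by positivity),
    one_mul]
  exact hc k

variable [CompleteSpace R]

theorem contDiff_ofScalarsSum {c : ℕ → ℝ}
    (hc : (FormalMultilinearSeries.ofScalars R c).radius = ⊤) :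
    ContDiff ℝ ∞ (FormalMultilinearSeries.ofScalarsSum c : R → R) ∧
      HasFDerivAt (FormalMultilinearSeries.ofScalarsSum c : R → R)
        (c 1 • ContinuousLinearMap.id ℝ R) 0 := by
  have h := (FormalMultilinearSeries.ofScalars R c).hasFPowerSeriesOnBall (by simp [hc])
  refine ⟨contDiff_iff_contDiffAt.2 fun x =>
    (h.analyticAt_of_mem (by simp [hc])).contDiffAt, ?_⟩
  refine HasFDerivAt.congr_fderiv h.hasFPowerSeriesAt.hasFDerivAt ?_
  ext v
  simp [FormalMultilinearSeries.ofScalars]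

theorem contDiff_cosOfSq : ContDiff ℝ ∞ (cosOfSq : R → R) ∧
    HasFDerivAt (cosOfSq : R → R) ((-(1 / 2) : ℝ) • ContinuousLinearMap.id ℝ R) 0 := by
  have h := contDiff_ofScalarsSum (R := R)
    (c := fun k : ℕ => (-1 : ℝ) ^ k / ((2 * k).factorial : ℝ)) (radius_ofScalars_eq_top ?_ ?_)
  · rw [FormalMultilinearSeries.ofScalarsSum_eq_tsum] at h
    exact ⟨h.1, h.2.congr_fderiv (by norm_num [Nat.factorial])⟩
  · intro k
    rw [abs_div, abs_div, abs_pow, abs_pow, abs_neg, abs_one, one_pow, one_pow, Nat.abs_cast,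
      Nat.abs_cast, show 2 * (k + 1) = 2 * k + 1 + 1 by ring, Nat.factorial_succ,
      Nat.factorial_succ]
    push_cast
    rw [div_mul_eq_mul_div, one_mul, div_le_div_iff₀ (by positivity) (by positivity)]
    have : (0 : ℝ) < ((2 * k).factorial : ℝ) := by positivity
    have hk : (0 : ℝ) ≤ k := by positivity
    nlinarith [mul_nonneg this.le hk, mul_nonneg (mul_nonneg this.le hk) hk]
  · intro k
    positivity

theorem contDiff_sincOfSq : ContDiff ℝ ∞ (sincOfSq : R → R) ∧
    HasFDerivAt (sincOfSq : R → R) ((-(1 / 6) : ℝ) • ContinuousLinearMap.id ℝ R) 0 := by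
  have h := contDiff_ofScalarsSum (R := R)
    (c := fun k : ℕ => (-1 : ℝ) ^ k / ((2 * k + 1).factorial : ℝ)) (radius_ofScalars_eq_top ?_ ?_)
  · rw [FormalMultilinearSeries.ofScalarsSum_eq_tsum] at h
    exact ⟨h.1, h.2.congr_fderiv (by norm_num [Nat.factorial])⟩
  · intro k
    rw [abs_div, abs_div, abs_pow, abs_pow, abs_neg, abs_one, one_pow, one_pow, Nat.abs_cast,
      Nat.abs_cast, show 2 * (k + 1) + 1 = 2 * k + 1 + 1 + 1 by ring,
      Nat.factorial_succ (2 * k + 1 + 1), Nat.factorial_succ (2 * k + 1)]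
    push_cast
    rw [div_mul_eq_mul_div, one_mul, div_le_div_iff₀ (by positivity) (by positivity)]
    have : (0 : ℝ) < ((2 * k + 1).factorial : ℝ) := by positivity
    have hk : (0 : ℝ) ≤ k := by positivity
    nlinarith [mul_nonneg this.le hk, mul_nonneg (mul_nonneg this.le hk) hk]
  · intro k
    positivity

theorem contDiffAt_tancOfSq : ContDiffAt ℝ ∞ (tancOfSq : R → R) 0 := by
  refine contDiff_sincOfSq.1.contDiffAt.mul (ContDiffAt.comp (g := Ring.inverse) 0 ?_
    contDiff_cosOfSq.1.contDiffAt)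
  rw [cosOfSq_zero]
  exact contDiffAt_ringInverse ℝ (1 : Rˣ)

theorem hasFDerivAt_tancOfSq :
    HasFDerivAt (tancOfSq : R → R) ((1 / 3 : ℝ) • ContinuousLinearMap.id ℝ R) 0 := by
  have h1 : HasFDerivAt (Ring.inverse : R → R) (-ContinuousLinearMap.id ℝ R)
      (cosOfSq (0 : R)) := by
    rw [cosOfSq_zero]
    refine HasFDerivAt.congr_fderiv (hasFDerivAt_ringInverse (𝕜 := ℝ) (1 : Rˣ)) ?_
    ext v
    simp
  refine (contDiff_sincOfSq.2.mul' (h1.comp (0 : R) contDiff_cosOfSq.2)).congr_fderiv ?_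
  ext v
  simp [sincOfSq_zero, cosOfSq_zero]
  module

/-- `tanc (s √S) = 1 + s² S / 3 + o(s²)`, also when `S` depends continuously on `s`. -/
theorem tancOfSq_sub_isLittleO {S : ℝ → R} (hS : ContinuousAt S 0) :
    (fun s : ℝ => tancOfSq (s ^ 2 • S s) - (1 + (s ^ 2 / 3) • S 0))
      =o[𝓝 0] fun s : ℝ => s ^ 2 := by
  have hO : (fun s : ℝ => s ^ 2 • S s) =O[𝓝 0] fun s : ℝ => s ^ 2 := by
    have := (isBigO_refl (fun s : ℝ => s ^ 2) (𝓝 0)).smul (hS.tendsto.isBigO_one ℝ)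
    simpa using this
  have ht : Tendsto (fun s : ℝ => s ^ 2 • S s) (𝓝 0) (𝓝 0) := by
    have : ContinuousAt (fun s : ℝ => s ^ 2 • S s) 0 := by fun_prop
    simpa [ContinuousAt] using this
  have h1 := (hasFDerivAt_tancOfSq (R := R)).isLittleO.comp_tendsto ht
  have h2 : (fun s : ℝ => s ^ 2 • (S s - S 0)) =o[𝓝 0] fun s : ℝ => s ^ 2 := by
    have h3 : (fun s => S s - S 0) =o[𝓝 0] fun _ : ℝ => (1 : ℝ) := by
      rw [isLittleO_one_iff]
      exact tendsto_sub_nhds_zero_iff.2 hS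
    have := (isBigO_refl (fun s : ℝ => s ^ 2) (𝓝 0)).smul_isLittleO h3
    simpa using this
  refine ((h1.trans_isBigO (hO.congr_left fun s => by simp)).add
    (h2.const_smul_left (1 / 3 : ℝ))).congr_left fun s => ?_
  simp only [Function.comp_apply, tancOfSq_zero, sub_zero, Pi.smul_apply,
    smul_apply, ContinuousLinearMap.id_apply]
  module

end Tanc

/-! ### Implicit one-step methods and smoothness of solutions -/

section OneStep

variable {F : Type*} [NormedAddCommGroup F] [NormedSpace ℝ F]

/-- The implicit equation of a one-step method is solvable for small step lengths. -/
theorem exists_tendsto_of_contDiffAt [CompleteSpace F] {Φ : ℝ × F → F} {z : F}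
    (hΦ : ContDiffAt ℝ 1 Φ (0, z)) :
    ∃ Z : ℝ → F, Tendsto Z (𝓝 0) (𝓝 z) ∧ ∀ᶠ h in 𝓝 (0 : ℝ), Z h = z + h • Φ (h, Z h) := by
  have hd : HasStrictFDerivAt (fun w : ℝ × F => w.2 - w.1 • Φ w)
      (ContinuousLinearMap.snd ℝ ℝ F - ((0 : ℝ) • fderiv ℝ Φ (0, z) +
        (ContinuousLinearMap.fst ℝ ℝ F).smulRight (Φ (0, z)))) (0, z) :=
    hasStrictFDerivAt_snd.fun_sub
      (hasStrictFDerivAt_fst.fun_smul (hΦ.hasStrictFDerivAt (by simp)))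
  have hinv : ((ContinuousLinearMap.snd ℝ ℝ F - ((0 : ℝ) • fderiv ℝ Φ (0, z) +
      (ContinuousLinearMap.fst ℝ ℝ F).smulRight (Φ (0, z)))) ∘L
        ContinuousLinearMap.inr ℝ ℝ F).IsInvertible :=
    ⟨ContinuousLinearEquiv.refl ℝ F, by ext v; simp⟩
  refine ⟨hd.implicitFunctionOfProdDomain hinv,
    hd.tendsto_implicitFunctionOfProdDomain hinv, ?_⟩
  filter_upwards [hd.eventually_apply_implicitFunctionOfProdDomain hinv] with h hh
  simpa [sub_eq_iff_eq_add] using hh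

/-- The error after one step has the order of the defect, i.e. of the residual of the
comparison curve `Y` in the implicit equation of the method. -/
theorem error_isBigO_iff_defect_isBigO {Φ : ℝ × F → F} {z : F} (hΦ : ContDiffAt ℝ 1 Φ (0, z))
    {Z Y : ℝ → F} (hZ : Tendsto Z (𝓝[>] 0) (𝓝 z)) (hY : Tendsto Y (𝓝[>] 0) (𝓝 z))
    (heq : ∀ᶠ h in 𝓝[>] (0 : ℝ), Z h = z + h • Φ (h, Z h)) (k : ℕ) :
    (fun h => Z h - Y h) =O[𝓝[>] 0] (fun h : ℝ => h ^ k) ↔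
      (fun h => Y h - z - h • Φ (h, Y h)) =O[𝓝[>] 0] (fun h : ℝ => h ^ k) := by
  obtain ⟨L, t, ht, hL⟩ := hΦ.exists_lipschitzOnWith
  have hid : Tendsto (fun h : ℝ => h) (𝓝[>] 0) (𝓝 0) := nhdsWithin_le_nhds
  have hZt := (hid.prodMk_nhds hZ).eventually ht
  have hYt := (hid.prodMk_nhds hY).eventually ht
  have hsmall : ∀ᶠ h : ℝ in 𝓝[>] (0 : ℝ), h * (L : ℝ) ≤ 1 / 2 := by
    have : Tendsto (fun h : ℝ => h * L) (𝓝[>] 0) (𝓝 0) := by simpa using hid.mul_const (L : ℝ)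
    exact this.eventually_le_const one_half_pos
  have key : ∀ᶠ h in 𝓝[>] (0 : ℝ), ‖h • (Φ (h, Z h) - Φ (h, Y h))‖ ≤ 1 / 2 * ‖Z h - Y h‖ := by
    filter_upwards [hZt, hYt, hsmall, self_mem_nhdsWithin] with h h1 h2 h3 h4
    have h4 : 0 < h := h4
    have h5 := hL.norm_sub_le h1 h2
    rw [Prod.mk_sub_mk, sub_self, Prod.norm_mk, norm_zero,
      max_eq_right (norm_nonneg _)] at h5
    rw [norm_smul, Real.norm_of_nonneg h4.le]
    calc h * ‖Φ (h, Z h) - Φ (h, Y h)‖ ≤ h * (L * ‖Z h - Y h‖) := by gcongr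
      _ = h * L * ‖Z h - Y h‖ := by ring
      _ ≤ 1 / 2 * ‖Z h - Y h‖ := by gcongr
  have hsplit : ∀ᶠ h in 𝓝[>] (0 : ℝ), Y h - z - h • Φ (h, Y h) =
      h • (Φ (h, Z h) - Φ (h, Y h)) - (Z h - Y h) := by
    filter_upwards [heq] with h hh
    nth_rw 2 [hh]
    module
  constructor
  · refine fun H => IsBigO.trans (IsBigO.of_bound (3 / 2) ?_) H
    filter_upwards [key, hsplit] with h h1 h2
    rw [h2]
    linarith [norm_sub_le (h • (Φ (h, Z h) - Φ (h, Y h))) (Z h - Y h)]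
  · refine fun H => IsBigO.trans (IsBigO.of_bound 2 ?_) H
    filter_upwards [key, hsplit] with h h1 h2
    rw [h2, norm_sub_rev (h • _)]
    linarith [norm_sub_norm_le (Z h - Y h) (h • (Φ (h, Z h) - Φ (h, Y h)))]

/-- Solutions of a smooth autonomous differential equation are smooth, by bootstrapping. -/
theorem contDiffAt_of_hasDerivAt_vectorField {v : F → F} {γ : ℝ → F}
    (hv : ContDiffAt ℝ ∞ v (γ 0)) (hγ : ∀ᶠ t in 𝓝 (0 : ℝ), HasDerivAt γ (v (γ t)) t) :
    ContDiffAt ℝ ∞ γ 0 := by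
  rw [contDiffAt_infty]
  intro n
  induction n with
  | zero =>
    rw [Nat.cast_zero, contDiffAt_zero]
    exact ⟨_, hγ, fun t ht => (HasDerivAt.continuousAt ht).continuousWithinAt⟩
  | succ n ih =>
    push_cast
    rw [contDiffAt_succ_iff_hasFDerivAt]
    refine ⟨fun t => (1 : ℝ →L[ℝ] ℝ).smulRight (v (γ t)), ⟨_, hγ, fun t ht => ?_⟩, ?_⟩
    · exact HasDerivAt.hasFDerivAt ht
    · have h1 : ContDiffAt ℝ n (fun t => v (γ t)) 0 :=
        ContDiffAt.comp (g := v) 0 (hv.of_le (by exact_mod_cast le_top)) ih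
      exact contDiffAt_const.smulRight h1

theorem inverse_apply_eq_iff {T : F →L[ℝ] F} (hT : IsUnit T) (v w : F) :
    Ring.inverse T v = w ↔ v = T w := by
  constructor
  · rintro rfl
    rw [← mul_apply_eq_comp, Ring.mul_inverse_cancel T hT, one_apply_eq_self]
  · rintro rfl
    rw [← mul_apply_eq_comp, Ring.inverse_mul_cancel T hT, one_apply_eq_self]

end OneStep

/-! ### The increment function of the scheme -/

section Scheme

variable {E : Type*} [NormedAddCommGroup E] [InnerProductSpace ℝ E] [CompleteSpace E]

/-- The increment function of the scheme in phase space: `z' = (x', p')` is the result of one step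
of length `h` from `z = (x, p)` if and only if `z' = z + h Φ(h, z, z')`. -/
def stepMap (V : E → ℝ) (G : E → E → E) (h : ℝ)
    (z z' : E × E) : E × E :=
  (tancOfSq ((h / 2) ^ 2 • fderiv ℝ (∇ V) (midpoint ℝ z.1 z'.1)) ((1 / 2 : ℝ) • (z.2 + z'.2)),
    -(ContinuousLinearMap.adjoint (tancOfSq ((h / 2) ^ 2 • fderiv ℝ (∇ V) (midpoint ℝ z.1 z'.1)))
      (G z.1 z'.1)))

/-- The implicit equations of the scheme, solved for the new state; `T` stands for the matrix
`tanc (h Ω / 2)`. -/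
theorem isUnit_and_inverse_eq_iff_eq_add_smul_stepMap {V : E → ℝ} {G : E → E → E} {h : ℝ}
    {z z' : E × E} {T : E →L[ℝ] E}
    (hT : tancOfSq ((h / 2) ^ 2 • fderiv ℝ (∇ V) (midpoint ℝ z.1 z'.1)) = T)
    (hu : IsUnit (h • T)) :
    (IsUnit (h • T) ∧ Ring.inverse (h • T) (z'.1 - z.1) = (1 / 2 : ℝ) • (z.2 + z'.2) ∧
      Ring.inverse (ContinuousLinearMap.adjoint (h • T)) (z'.2 - z.2) = -G z.1 z'.1) ↔
    z' = z + h • stepMap V G h z z' := by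
  have hu' : IsUnit (ContinuousLinearMap.adjoint (h • T)) := by
    rw [← ContinuousLinearMap.star_eq_adjoint]
    exact hu.star
  rw [and_iff_right hu, inverse_apply_eq_iff hu, inverse_apply_eq_iff hu', Prod.ext_iff]
  simp only [hT, stepMap, Prod.fst_add, Prod.snd_add, Prod.smul_fst, Prod.smul_snd,
    ← ContinuousLinearMap.star_eq_adjoint, star_smul, star_trivial, smul_apply,
    sub_eq_iff_eq_add', map_neg, smul_neg]

theorem isStep_iff {m : ℕ} {V : Space m → ℝ} {G : Space m → Space m → Space m} {h : ℝ}
    {z z' : Space m × Space m} (hu : IsUnit (delta V h (midpoint ℝ z.1 z'.1))) :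
    IsStep V G h z.1 z.2 z'.1 z'.2 ↔ z' = z + h • stepMap V G h z z' :=
  isUnit_and_inverse_eq_iff_eq_add_smul_stepMap rfl hu

variable {V : E → ℝ} {G : E → E → E}

theorem contDiffAt_gradient {x : E} (hV : ContDiffAt ℝ ∞ V x) : ContDiffAt ℝ ∞ (∇ V) x :=
  (InnerProductSpace.toDual ℝ (E)).symm.contDiff.contDiffAt.comp x
    (hV.fderiv_right (m := ∞) (by simp))

theorem contDiffAt_hessian {x : E} (hV : ContDiffAt ℝ ∞ V x) :
    ContDiffAt ℝ ∞ (fderiv ℝ (∇ V)) x :=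
  (contDiffAt_gradient hV).fderiv_right (m := ∞) (by simp)

theorem adjoint_hessian {x : E} (hV : ContDiffAt ℝ ∞ V x) :
    ContinuousLinearMap.adjoint (fderiv ℝ (∇ V) x) = fderiv ℝ (∇ V) x := by
  have hsymm : IsSymmSndFDerivAt ℝ V x := hV.isSymmSndFDerivAt (by
    rw [minSmoothness_of_isRCLikeNormedField]; exact WithTop.coe_le_coe.2 le_top)
  have hd : DifferentiableAt ℝ (fderiv ℝ V) x :=
    (hV.fderiv_right (m := ∞) (by simp)).differentiableAt (by simp)
  have hinner : ∀ u v : E, ⟪fderiv ℝ (∇ V) x u, v⟫ = fderiv ℝ (fderiv ℝ V) x u v := by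
    intro u v
    have h1 : HasFDerivAt (∇ V)
        ((InnerProductSpace.toDual ℝ (E)).symm.toContinuousLinearEquiv.toContinuousLinearMap
          ∘L fderiv ℝ (fderiv ℝ V) x) x :=
      ((InnerProductSpace.toDual ℝ (E)).symm.toContinuousLinearEquiv
        |>.hasFDerivAt).comp x hd.hasFDerivAt
    rw [h1.fderiv]
    exact InnerProductSpace.toDual_symm_apply
  refine (ContinuousLinearMap.eq_adjoint_iff _ _).2 (fun u v => ?_) |>.symm
  rw [hinner, hsymm.eq, ← hinner, real_inner_comm]

theorem contDiffAt_tancOfSq_hessian {z : E × E} (hV : ContDiffAt ℝ ∞ V z.1) :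
    ContDiffAt ℝ ∞ (fun w : ℝ × (E × E) × (E × E) =>
      tancOfSq ((w.1 / 2) ^ 2 • fderiv ℝ (∇ V) (midpoint ℝ w.2.1.1 w.2.2.1))) (0, z, z) := by
  have hmid : ContDiffAt ℝ ∞ (fun w : ℝ × (E × E) × (E × E) =>
      midpoint ℝ w.2.1.1 w.2.2.1) (0, z, z) := by
    simp only [midpoint_eq_smul_add]
    fun_prop
  have hS : ContDiffAt ℝ ∞ (fun w : ℝ × (E × E) × (E × E) =>
      (w.1 / 2) ^ 2 • fderiv ℝ (∇ V) (midpoint ℝ w.2.1.1 w.2.2.1)) (0, z, z) := by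
    refine ContDiffAt.smul (((contDiffAt_fst).div_const 2).pow 2) ?_
    refine ContDiffAt.comp (g := fderiv ℝ (∇ V)) _ ?_ hmid
    simpa using contDiffAt_hessian hV
  refine ContDiffAt.comp (g := tancOfSq) _ ?_ hS
  simpa using contDiffAt_tancOfSq

theorem contDiffAt_stepMap {z : E × E} (hV : ContDiffAt ℝ ∞ V z.1)
    (hG : ContDiffAt ℝ ∞ (fun w : E × E => G w.1 w.2) (z.1, z.1)) :
    ContDiffAt ℝ ∞ (fun w : ℝ × (E × E) × (E × E) =>
      stepMap V G w.1 w.2.1 w.2.2) (0, z, z) := by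
  have hT := contDiffAt_tancOfSq_hessian hV
  have hG' : ContDiffAt ℝ ∞ (fun w : ℝ × (E × E) × (E × E) =>
      G w.2.1.1 w.2.2.1) (0, z, z) :=
    ContDiffAt.comp (g := fun w : E × E => G w.1 w.2)
      (f := fun w : ℝ × (E × E) × (E × E) => (w.2.1.1, w.2.2.1)) (0, z, z)
      hG (by fun_prop)
  refine (hT.clm_apply (by fun_prop)).prodMk (ContDiffAt.neg ?_)
  refine ContDiffAt.clm_apply ?_ hG'
  exact (starL' ℝ (A := E →L[ℝ] E)).contDiff.contDiffAt.comp _ hT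

theorem contDiffAt_stepMap_right {z : E × E} (hV : ContDiffAt ℝ ∞ V z.1)
    (hG : ContDiffAt ℝ ∞ (fun w : E × E => G w.1 w.2) (z.1, z.1)) :
    ContDiffAt ℝ 1 (fun w : ℝ × (E × E) => stepMap V G w.1 z w.2) (0, z) :=
  ContDiffAt.comp (g := fun w : ℝ × (E × E) × (E × E) =>
      stepMap V G w.1 w.2.1 w.2.2) (f := fun w : ℝ × (E × E) => (w.1, z, w.2)) (0, z)
    ((contDiffAt_stepMap hV hG).of_le (by simp)) (by fun_prop)

/-- The implicit equations have a solution for small step lengths, and the matrix `δ` is then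
invertible. -/
theorem exists_tendsto_step {z : E × E} (hV : ContDiffAt ℝ ∞ V z.1)
    (hG : ContDiffAt ℝ ∞ (fun w : E × E => G w.1 w.2) (z.1, z.1)) :
    ∃ Z : ℝ → E × E, Tendsto Z (𝓝 0) (𝓝 z) ∧ ∀ᶠ h in 𝓝[>] (0 : ℝ),
      IsUnit (h • tancOfSq ((h / 2) ^ 2 • fderiv ℝ (∇ V) (midpoint ℝ z.1 (Z h).1))) ∧
        Z h = z + h • stepMap V G h z (Z h) := by
  obtain ⟨Z, hZ, heq⟩ := exists_tendsto_of_contDiffAt (contDiffAt_stepMap_right hV hG)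
  refine ⟨Z, hZ, ?_⟩
  have hT : Tendsto (fun h : ℝ =>
      tancOfSq ((h / 2) ^ 2 • fderiv ℝ (∇ V) (midpoint ℝ z.1 (Z h).1))) (𝓝 0) (𝓝 1) := by
    have h1 := (contDiffAt_tancOfSq_hessian (z := z) hV).continuousAt.tendsto.comp
      (tendsto_id.prodMk_nhds (tendsto_const_nhds.prodMk_nhds hZ))
    simpa [tancOfSq_zero, Function.comp_def] using h1
  have hunit := hT.eventually (Units.isOpen.mem_nhds (isUnit_one (M := E →L[ℝ] E)))
  filter_upwards [nhdsWithin_le_nhds heq, nhdsWithin_le_nhds hunit, self_mem_nhdsWithin]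
    with h h1 h2 h3
  exact ⟨h2.smul (Units.mk0 h (ne_of_gt h3)), h1⟩

end Scheme

/-! ### The leading term of the defect -/

section Defect

/-- Product of the expansions of a matrix and of a vector, multiplied by the step length `2 s`. -/
theorem clm_apply_sub_isLittleO {E : Type*} [NormedAddCommGroup E] [NormedSpace ℝ E]
    {T : ℝ → E →L[ℝ] E} {T₂ : E →L[ℝ] E} {y : ℝ → E} {y₀ y₂ : E}
    (hT : (fun s : ℝ => T s - (1 + (s ^ 2 / 3) • T₂)) =o[𝓝 0] fun s : ℝ => s ^ 2)
    (hy : (fun s : ℝ => y s - (y₀ + (s ^ 2 / 2) • y₂)) =o[𝓝 0] fun s : ℝ => s ^ 2) :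
    (fun s : ℝ => (2 * s) • T s (y s) -
      ((2 * s) • y₀ + s ^ 3 • ((2 / 3 : ℝ) • T₂ y₀ + y₂))) =o[𝓝 0] fun s : ℝ => s ^ 3 := by
  have hy1 : y =O[𝓝 0] fun _ : ℝ => (1 : ℝ) := by
    have h1 : (fun s : ℝ => y₀ + (s ^ 2 / 2) • y₂) =O[𝓝 0] fun _ : ℝ => (1 : ℝ) := by
      have : ContinuousAt (fun s : ℝ => y₀ + (s ^ 2 / 2) • y₂) 0 := by fun_prop
      exact this.tendsto.isBigO_one ℝ
    have h2 : (fun s : ℝ => s ^ 2) =O[𝓝 0] fun _ : ℝ => (1 : ℝ) :=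
      (show ContinuousAt (fun s : ℝ => s ^ 2) 0 by fun_prop).tendsto.isBigO_one ℝ
    simpa using (hy.isBigO.trans h2).add h1
  have e1 : (fun s : ℝ => (T s - (1 + (s ^ 2 / 3) • T₂) : E →L[ℝ] E) (y s)) =o[𝓝 0] fun s : ℝ => s ^ 2 := by
    have := hT.norm_left.mul_isBigO hy1.norm_left
    simp only [mul_one] at this
    refine IsBigO.trans_isLittleO (IsBigO.of_bound 1 (Eventually.of_forall fun s => ?_)) this
    rw [one_mul, Real.norm_of_nonneg (by positivity)]
    exact ContinuousLinearMap.le_opNorm _ _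
  have e2 : (fun s : ℝ => (s ^ 2 / 3) • T₂ (y s - y₀)) =o[𝓝 0] fun s : ℝ => s ^ 2 := by
    have h1 : (fun s : ℝ => y s - y₀) =o[𝓝 0] fun _ : ℝ => (1 : ℝ) := by
      have h2 : (fun s : ℝ => s ^ 2) =o[𝓝 0] fun _ : ℝ => (1 : ℝ) := by
        simpa using isLittleO_pow_pow (𝕜 := ℝ) (show 0 < 2 by norm_num)
      have h3 : (fun s : ℝ => (s ^ 2 / 2) • y₂) =o[𝓝 0] fun _ : ℝ => (1 : ℝ) := by
        rw [isLittleO_one_iff]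
        have : ContinuousAt (fun s : ℝ => (s ^ 2 / 2) • y₂) 0 := by fun_prop
        simpa [ContinuousAt] using this
      exact ((hy.trans h2).add h3).congr_left fun s => by abel
    have h4 := (isBigO_refl (fun s : ℝ => s ^ 2) (𝓝 0)).smul_isLittleO
      ((T₂.isBigO_comp (fun s => y s - y₀) (𝓝 0)).trans_isLittleO h1)
    refine ((h4.congr_right fun s => by simp).const_smul_left (1 / 3 : ℝ)).congr_left fun s => ?_
    simp only [Pi.smul_apply]
    module
  have e3 : (fun s : ℝ => T s (y s) - (y₀ + s ^ 2 • ((1 / 3 : ℝ) • T₂ y₀ + (1 / 2 : ℝ) • y₂)))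
      =o[𝓝 0] fun s : ℝ => s ^ 2 := by
    refine ((e1.add e2).add hy).congr_left fun s => ?_
    simp only [sub_apply, add_apply, smul_apply, one_apply_eq_self, map_sub]
    module
  refine (((isBigO_refl (fun s : ℝ => 2 * s) (𝓝 0)).smul_isLittleO e3).congr_left
    fun s => ?_).trans_isBigO (IsBigO.of_bound 2 (Eventually.of_forall fun s => ?_))
  · module
  · simp only [smul_eq_mul, norm_mul, norm_pow, Real.norm_ofNat]
    exact le_of_eq (by ring)

/-- A centred difference is the integral of the even part of the derivative. -/
theorem centered_difference_sub_isLittleO {E : Type*} [NormedAddCommGroup E] [NormedSpace ℝ E]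
    {f f' : ℝ → E} {a b : E}
    (hf : ∀ᶠ s in 𝓝 (0 : ℝ), HasDerivAt f (f' s) s)
    (hf' : (fun s => (1 / 2 : ℝ) • (f' (-s) + f' s) - (a + (s ^ 2 / 2) • b))
      =o[𝓝 0] fun s : ℝ => s ^ 2) :
    (fun s => f s - f (-s) - ((2 * s) • a + s ^ 3 • ((1 / 3 : ℝ) • b)))
      =o[𝓝 0] fun s : ℝ => s ^ 3 := by
  have hneg : Tendsto (fun s : ℝ => -s) (𝓝 0) (𝓝 0) := by
    simpa using (continuous_neg (G := ℝ)).tendsto 0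
  refine isLittleO_pow_succ_of_hasDerivAt
    (f' := fun s => f' s + f' (-s) - ((2 : ℝ) • a + s ^ 2 • b)) ?_ ?_ (by simp)
  · filter_upwards [hf, hneg.eventually hf] with s h1 h2
    have h3 : HasDerivAt (fun s => f (-s)) (-f' (-s)) s := by
      simpa [Function.comp_def] using h2.scomp s (hasDerivAt_neg s)
    have h4 : HasDerivAt (fun s : ℝ => (2 * s) • a + s ^ 3 • ((1 / 3 : ℝ) • b))
        ((2 : ℝ) • a + s ^ 2 • b) s := by
      have h5 := ((hasDerivAt_id s).const_mul 2).smul_const a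
      have h6 := (hasDerivAt_pow 3 s).smul_const ((1 / 3 : ℝ) • b)
      refine (h5.add h6).congr_deriv ?_
      simp
      module
    exact ((h1.sub h3).sub h4).congr_deriv (by abel)
  · refine (hf'.const_smul_left (2 : ℝ)).congr_left fun s => ?_
    simp only [Pi.smul_apply]
    module

variable {E : Type*} [NormedAddCommGroup E] [InnerProductSpace ℝ E] [CompleteSpace E]
  {V : E → ℝ} {G : E → E → E}

/-- The Hamiltonian vector field `(x, p) ↦ (p, -∇V(x))`. -/
def vectorField (V : E → ℝ) (z : E × E) : E × E := (z.2, -(∇ V z.1))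

/-- The coefficient of `s³` in the defect of the exact solution over the time interval
`[-s, s]`, for the momentum component; `(x, p)` is the state at the centre of the interval. -/
def defectCoeff (V : E → ℝ) (G : E → E → E) (x p : E) : E :=
  (4 : ℝ) • (fderiv ℝ (fderiv ℝ fun w : E × E => G w.1 w.2) (x, x) (0, p) (0, p) -
    (1 / 3 : ℝ) • fderiv ℝ (fderiv ℝ (∇ V)) x p p)

theorem contDiffAt_vectorField {z : E × E} (hV : ContDiffAt ℝ ∞ V z.1) :
    ContDiffAt ℝ ∞ (vectorField V) z :=
  contDiffAt_snd.prodMk ((contDiffAt_gradient hV).comp z contDiffAt_fst).neg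

/-- The second order terms of a symmetric discrete gradient in the direction of a symmetric pair
of points. -/
theorem fderiv_fderiv_discreteGradient {x : E} (hV : ContDiffAt ℝ ∞ V x)
    (hG : ContDiffAt ℝ ∞ (fun w : E × E => G w.1 w.2) (x, x))
    (hdiag : ∀ᶠ y in 𝓝 x, G y y = ∇ V y)
    (hsymm : ∀ᶠ w in 𝓝 (x, x), G w.1 w.2 = G w.2 w.1) (p : E) :
    fderiv ℝ (fderiv ℝ fun w : E × E => G w.1 w.2) (x, x) (-p, p) (-p, p) =
      (4 : ℝ) • fderiv ℝ (fderiv ℝ fun w : E × E => G w.1 w.2) (x, x) (0, p) (0, p) -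
        fderiv ℝ (fderiv ℝ (∇ V)) x p p := by
  have hG2 := hG.of_le (m := 2) (WithTop.coe_le_coe.2 le_top)
  have hV2 := (contDiffAt_gradient hV).of_le (m := 2) (WithTop.coe_le_coe.2 le_top)
  have hline : Tendsto (fun s : ℝ => x + s • p) (𝓝 0) (𝓝 x) := by
    have : Continuous fun s : ℝ => x + s • p := by fun_prop
    simpa using this.tendsto 0
  have h1 := (fderiv_eq_of_eventuallyEq_line hG2 hV2 (v := (p, p)) (w := p) (by
    filter_upwards [hline.eventually hdiag] with s hs
    simpa using hs)).2
  have h2 := (fderiv_eq_of_eventuallyEq_line hG2 hG2 (v := (p, 0)) (w := (0, p)) (by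
    filter_upwards [(hline.prodMk_nhds (tendsto_const_nhds (x := x))).eventually hsymm] with s hs
    simpa using hs)).2
  set Q := fderiv ℝ (fderiv ℝ fun w : E × E => G w.1 w.2) (x, x)
  have h3 : (p, p) = (p, 0) + ((0, p) : E × E) := by simp
  have h4 : (-p, p) = (0, p) - ((p, 0) : E × E) := by simp
  rw [h3] at h1
  rw [h4, ← h1]
  simp only [map_add, map_sub, add_apply, sub_apply]
  rw [h2]
  module

/-- The third order expansion of the defect of the exact solution over `[-s, s]`. -/
theorem defect_sub_isLittleO {γ : ℝ → E × E} (hV : ContDiffAt ℝ ∞ V (γ 0).1)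
    (hG : ContDiffAt ℝ ∞ (fun w : E × E => G w.1 w.2) ((γ 0).1, (γ 0).1))
    (hdiag : ∀ᶠ y in 𝓝 (γ 0).1, G y y = ∇ V y)
    (hsymm : ∀ᶠ w in 𝓝 ((γ 0).1, (γ 0).1), G w.1 w.2 = G w.2 w.1)
    (hγ : ∀ᶠ t in 𝓝 (0 : ℝ), HasDerivAt γ (vectorField V (γ t)) t) :
    (fun s : ℝ => γ s - γ (-s) - (2 * s) • stepMap V G (2 * s) (γ (-s)) (γ s) -
      s ^ 3 • ((0 : E), defectCoeff V G (γ 0).1 (γ 0).2)) =o[𝓝 0] fun s : ℝ => s ^ 3 := by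
  obtain ⟨x, hx⟩ : ∃ x, x = (γ 0).1 := ⟨_, rfl⟩
  obtain ⟨p, hp⟩ : ∃ p, p = (γ 0).2 := ⟨_, rfl⟩
  rw [← hx] at hV hG hdiag hsymm
  rw [← hx, ← hp]
  have hgrad2 := (contDiffAt_gradient hV).of_le (m := 2) (WithTop.coe_le_coe.2 le_top)
  have hG2 := hG.of_le (m := 2) (WithTop.coe_le_coe.2 le_top)
  have hgx : G x x = ∇ V x := hdiag.self_of_nhds
  have hneg : Tendsto (fun s : ℝ => -s) (𝓝 0) (𝓝 0) := by
    simpa using (continuous_neg (G := ℝ)).tendsto 0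
  have hξ : ∀ᶠ t in 𝓝 (0 : ℝ), HasDerivAt (fun s => (γ s).1) (γ t).2 t := by
    filter_upwards [hγ] with t ht
    exact ht.fst
  have hη : ∀ᶠ t in 𝓝 (0 : ℝ), HasDerivAt (fun s => (γ s).2) (-(∇ V (γ t).1)) t := by
    filter_upwards [hγ] with t ht
    exact ht.snd
  have hη0 : HasDerivAt (fun s => (γ s).2) (-(∇ V x)) 0 := hx ▸ hη.self_of_nhds
  obtain ⟨hN, hN'⟩ := hasDerivAt_comp_twice hgrad2 hξ hη0 hx.symm
  rw [← hp] at hN'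
  set S := fderiv ℝ (∇ V) x with hS
  set Q₃ := fderiv ℝ (fderiv ℝ (∇ V)) x p p with hQ₃
  -- Even parts of the momentum and of the force along the solution.
  have hmean : (fun s : ℝ => (1 / 2 : ℝ) • ((γ (-s)).2 + (γ s).2) - (p + (s ^ 2 / 2) • -(S p)))
      =o[𝓝 0] fun s : ℝ => s ^ 2 := by
    have h := even_part_sub_taylor_two_isLittleO hη hN.self_of_nhds.neg
    simpa only [← hx, ← hp] using h
  have hforce : (fun s : ℝ => (1 / 2 : ℝ) • (-(∇ V (γ (-s)).1) + -(∇ V (γ s).1)) -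
      (-(∇ V x) + (s ^ 2 / 2) • -(Q₃ + S (-(∇ V x))))) =o[𝓝 0] fun s : ℝ => s ^ 2 := by
    have h := (even_part_sub_taylor_two_isLittleO hN hN').neg_left
    simp only [← hx] at h
    refine h.congr_left fun s => ?_
    module
  have hposition := centered_difference_sub_isLittleO hξ hmean
  have hmomentum := centered_difference_sub_isLittleO hη hforce
  -- The discrete gradient at the end points: an even function of `s`, by symmetry.
  have hζ : ∀ᶠ t in 𝓝 (0 : ℝ),
      HasDerivAt (fun s => ((γ (-s)).1, (γ s).1)) (-(γ (-t)).2, (γ t).2) t := by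
    filter_upwards [hξ, hneg.eventually hξ] with t h1 h2
    exact HasDerivAt.prodMk (by
      simpa [Function.comp_def] using h2.scomp t (hasDerivAt_neg t)) h1
  have hζ' : HasDerivAt (fun s => (-(γ (-s)).2, (γ s).2)) (-(∇ V x), -(∇ V x)) 0 := by
    refine HasDerivAt.prodMk ?_ hη0
    have h1 : HasDerivAt (fun s => (γ s).2) (-(∇ V x)) (-0) := by simpa using hη0
    simpa [Function.comp_def] using (h1.scomp (0 : ℝ) (hasDerivAt_neg 0)).fun_neg
  have hdG : fderiv ℝ (fun w : E × E => G w.1 w.2) (x, x) (-(∇ V x), -(∇ V x)) =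
      S (-(∇ V x)) := by
    refine (fderiv_eq_of_eventuallyEq_line hG2 hgrad2 ?_).1
    have : Continuous fun s : ℝ => x + s • -(∇ V x) := by fun_prop
    filter_upwards [(this.tendsto' 0 x (by simp)).eventually hdiag] with s hs
    simpa using hs
  have hdisc : (fun s : ℝ => G (γ (-s)).1 (γ s).1 - (∇ V x + (s ^ 2 / 2) •
      ((4 : ℝ) • fderiv ℝ (fderiv ℝ fun w : E × E => G w.1 w.2) (x, x) (0, p) (0, p) - Q₃ +
        S (-(∇ V x))))) =o[𝓝 0] fun s : ℝ => s ^ 2 := by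
    obtain ⟨h1, h2⟩ := hasDerivAt_comp_twice hG2 hζ hζ' (by simp [← hx])
    have h3 := even_part_sub_taylor_two_isLittleO h1 h2
    simp only [neg_zero, ← hx, ← hp, hdG, hgx,
      fderiv_fderiv_discreteGradient hV hG hdiag hsymm, neg_neg] at h3
    refine h3.congr' ?_ EventuallyEq.rfl
    have hζ0 : Tendsto (fun s => ((γ (-s)).1, (γ s).1)) (𝓝 0) (𝓝 (x, x)) := by
      have := hζ.self_of_nhds.continuousAt.tendsto
      simpa [← hx] using this
    filter_upwards [hζ0.eventually hsymm] with s hs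
    rw [hs]
    module
  -- The matrix `tanc`; its transpose has the same expansion because the Hessian is symmetric.
  have htanc : (fun s : ℝ => tancOfSq ((2 * s / 2) ^ 2 •
      fderiv ℝ (∇ V) (midpoint ℝ (γ (-s)).1 (γ s).1)) - (1 + (s ^ 2 / 3) • S))
        =o[𝓝 0] fun s : ℝ => s ^ 2 := by
    have hc : ContinuousAt (fun s : ℝ => fderiv ℝ (∇ V) (midpoint ℝ (γ (-s)).1 (γ s).1)) 0 := by
      have h1 : ContinuousAt (fun s : ℝ => midpoint ℝ (γ (-s)).1 (γ s).1) 0 := by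
        have h2 := hζ.self_of_nhds.continuousAt
        simp only [midpoint_eq_smul_add]
        exact (h2.fst.add h2.snd).const_smul _
      refine ContinuousAt.comp (g := fderiv ℝ (∇ V)) ?_ h1
      simpa [← hx] using (contDiffAt_hessian hV).continuousAt
    have h := tancOfSq_sub_isLittleO hc
    simpa [← hx] using h
  have htancT : (fun s : ℝ => ContinuousLinearMap.adjoint (tancOfSq ((2 * s / 2) ^ 2 •
      fderiv ℝ (∇ V) (midpoint ℝ (γ (-s)).1 (γ s).1))) - (1 + (s ^ 2 / 3) • S))
        =o[𝓝 0] fun s : ℝ => s ^ 2 := by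
    refine htanc.norm_left.congr_left (fun s => ?_) |>.of_norm_left
    rw [← (ContinuousLinearMap.adjoint (𝕜 := ℝ) (E := E) (F := E)).norm_map]
    simp only [← ContinuousLinearMap.star_eq_adjoint, star_sub, star_add, star_one, star_smul,
      star_trivial]
    rw [ContinuousLinearMap.star_eq_adjoint S, adjoint_hessian hV]
  -- Position: `-S p / 3 - (2 / 3 - 1) S p = 0`. In the momentum, `S ∇V` has coefficient
  -- `1 / 3 + 2 / 3 - 1 = 0`.
  have h1 := hposition.sub (clm_apply_sub_isLittleO htanc hmean)
  have h2 := hmomentum.add (clm_apply_sub_isLittleO htancT hdisc)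
  refine (h1.prod_left h2).congr_left fun s => Prod.ext ?_ ?_
  · simp only [stepMap, Prod.fst_sub, Prod.smul_fst]
    module
  · simp only [stepMap, Prod.snd_sub, Prod.smul_snd, map_neg, defectCoeff, ← hQ₃]
    module

end Defect

/-! ### Defect and order -/

section Order

variable {E : Type*} [NormedAddCommGroup E] [InnerProductSpace ℝ E] [CompleteSpace E]
  {V : E → ℝ} {U : Set E} {G : E → E → E}

/-- `G` is smooth near the diagonal of the open set `U`, symmetric there, and equals the gradient
of the smooth potential `V` on the diagonal. This is all the convergence analysis needs to know of
a symmetric discrete gradient. -/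
structure IsSymmetricForce (V : E → ℝ) (U : Set E) (G : E → E → E) : Prop where
  isOpen : IsOpen U
  potential : ∀ x ∈ U, ContDiffAt ℝ ∞ V x
  smooth : ∀ x ∈ U, ContDiffAt ℝ ∞ (fun w : E × E => G w.1 w.2) (x, x)
  diag : ∀ x ∈ U, G x x = ∇ V x
  symm : ∀ x ∈ U, ∀ᶠ w in 𝓝 (x, x), G w.1 w.2 = G w.2 w.1

/-- The method is symmetric: exchanging the end points and reversing time gives the same step. -/
theorem stepMap_neg_swap {h : ℝ} {z z' : E × E} (hsymm : G z.1 z'.1 = G z'.1 z.1) :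
    stepMap V G (-h) z' z = stepMap V G h z z' := by
  simp only [stepMap, neg_div, neg_sq, hsymm, midpoint_comm (R := ℝ) z.1 z'.1, add_comm z.2]

/-- The defect over the time interval `[c - s, c + s]` of a solution of Hamilton's equations is a
smooth odd function of `s`, with leading term given by `defectCoeff`. -/
theorem defect_isBigO {γ : ℝ → E × E} (H : IsSymmetricForce V U G) (h0 : (γ 0).1 ∈ U)
    (hγ : ∀ᶠ t in 𝓝 (0 : ℝ), HasDerivAt γ (vectorField V (γ t)) t) :
    (fun w : ℝ × ℝ => γ (w.2 + w.1) - γ (w.2 - w.1) -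
      (2 * w.1) • stepMap V G (2 * w.1) (γ (w.2 - w.1)) (γ (w.2 + w.1)) -
        w.1 ^ 3 • ((0 : E), defectCoeff V G (γ w.2).1 (γ w.2).2)) =O[𝓝 0]
          (fun w : ℝ × ℝ => w.1 ^ 5) ∧
      ContinuousAt (fun c : ℝ => ((0 : E), defectCoeff V G (γ c).1 (γ c).2)) 0 := by
  have hγs : ContDiffAt ℝ ∞ γ 0 :=
    contDiffAt_of_hasDerivAt_vectorField (contDiffAt_vectorField (H.potential _ h0)) hγ
  have hplus : ContDiffAt ℝ ∞ (fun w : ℝ × ℝ => γ (w.2 + w.1)) 0 :=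
    ContDiffAt.comp (g := γ) (f := fun w : ℝ × ℝ => w.2 + w.1) 0 (by simpa using hγs)
      (by fun_prop)
  have hminus : ContDiffAt ℝ ∞ (fun w : ℝ × ℝ => γ (w.2 - w.1)) 0 :=
    ContDiffAt.comp (g := γ) (f := fun w : ℝ × ℝ => w.2 - w.1) 0 (by simpa using hγs)
      (by fun_prop)
  have hends : Tendsto (fun w : ℝ × ℝ => ((γ (w.2 - w.1)).1, (γ (w.2 + w.1)).1)) (𝓝 0)
      (𝓝 ((γ 0).1, (γ 0).1)) := by
    have := (hminus.fst.prodMk hplus.fst).continuousAt.tendsto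
    simpa using this
  have hstep : ContDiffAt ℝ ∞ (fun w : ℝ × ℝ =>
      stepMap V G (2 * w.1) (γ (w.2 - w.1)) (γ (w.2 + w.1))) 0 := by
    refine ContDiffAt.comp (g := fun w : ℝ × (E × E) × (E × E) => stepMap V G w.1 w.2.1 w.2.2)
      (f := fun w : ℝ × ℝ => (2 * w.1, γ (w.2 - w.1), γ (w.2 + w.1))) 0 ?_ ?_
    · simpa using contDiffAt_stepMap (H.potential _ h0) (H.smooth _ h0)
    · exact ContDiffAt.prodMk (by fun_prop) (hminus.prodMk hplus)
  have hdefect : ContDiffAt ℝ ∞ (fun w : ℝ × ℝ => γ (w.2 + w.1) - γ (w.2 - w.1) -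
      (2 * w.1) • stepMap V G (2 * w.1) (γ (w.2 - w.1)) (γ (w.2 + w.1))) 0 :=
    (hplus.sub hminus).sub ((contDiffAt_const.mul contDiffAt_fst).smul hstep)
  refine isBigO_of_odd (K := fun c => ((0 : E), defectCoeff V G (γ c).1 (γ c).2)) hdefect ?_ ?_
  · filter_upwards [hends.eventually (H.symm _ h0)] with w hw
    simp only [sub_neg_eq_add, mul_neg, ← sub_eq_add_neg]
    rw [stepMap_neg_swap hw]
    module
  · have hU : ∀ᶠ c in 𝓝 (0 : ℝ), (γ c).1 ∈ U :=
      (hγs.continuousAt.fst).eventually (H.isOpen.mem_nhds h0)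
    -- For fixed `c`, the solution is translated in time so that `c` becomes the origin.
    filter_upwards [hU, hγ.eventually_nhds] with c hc hγc
    have hshift : Tendsto (fun s : ℝ => c + s) (𝓝 0) (𝓝 c) := by
      have : Continuous fun s : ℝ => c + s := by fun_prop
      simpa using this.tendsto 0
    have h := defect_sub_isLittleO (V := V) (G := G) (γ := fun s => γ (c + s))
      (by simpa using H.potential _ hc) (by simpa using H.smooth _ hc)
      (by simpa using (H.isOpen.eventually_mem hc).mono H.diag)
      (by simpa using H.symm _ hc) (by
        filter_upwards [hshift.eventually hγc] with s hs
        exact hs.comp_const_add c s)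
    simpa [← sub_eq_add_neg] using h

/-- The defect of a step of length `h` from time `0`, centred at time `h / 2`. -/
theorem defect_step_sub_isBigO {γ : ℝ → E × E} (H : IsSymmetricForce V U G) (h0 : (γ 0).1 ∈ U)
    (hγ : ∀ᶠ t in 𝓝 (0 : ℝ), HasDerivAt γ (vectorField V (γ t)) t) :
    (fun h : ℝ => γ h - γ 0 - h • stepMap V G h (γ 0) (γ h) -
      (h / 2) ^ 3 • ((0 : E), defectCoeff V G (γ (h / 2)).1 (γ (h / 2)).2)) =O[𝓝[>] 0]
        fun h : ℝ => h ^ 5 := by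
  have hhalf : Tendsto (fun h : ℝ => (h / 2, h / 2)) (𝓝[>] 0) (𝓝 0) := by
    have : Continuous fun h : ℝ => (h / 2, h / 2) := by fun_prop
    exact (this.tendsto' 0 0 (by simp)).mono_left nhdsWithin_le_nhds
  have h := (defect_isBigO H h0 hγ).1.comp_tendsto hhalf
  refine (h.congr_left fun t => ?_).trans (IsBigO.of_bound 1 (Eventually.of_forall fun t => ?_))
  · simp only [Function.comp_apply, add_halves, sub_self, mul_div_cancel₀ t two_ne_zero]
  · simp only [Function.comp_apply, div_pow, norm_div, one_mul]
    exact div_le_self (norm_nonneg _) (by norm_num)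

theorem defect_step_isBigO_pow_three {γ : ℝ → E × E} (H : IsSymmetricForce V U G)
    (h0 : (γ 0).1 ∈ U) (hγ : ∀ᶠ t in 𝓝 (0 : ℝ), HasDerivAt γ (vectorField V (γ t)) t) :
    (fun h : ℝ => γ h - γ 0 - h • stepMap V G h (γ 0) (γ h)) =O[𝓝[>] 0] fun h : ℝ => h ^ 3 := by
  have hhalf : Tendsto (fun h : ℝ => h / 2) (𝓝[>] 0) (𝓝 0) := by
    have : Continuous fun h : ℝ => h / 2 := by fun_prop
    exact (this.tendsto' 0 0 (by simp)).mono_left nhdsWithin_le_nhds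
  have h1 := ((defect_isBigO H h0 hγ).2.tendsto.comp hhalf).isBigO_one ℝ
  have h2 : (fun h : ℝ => (h / 2) ^ 3) =O[𝓝[>] 0] fun h : ℝ => h ^ 3 := by
    refine IsBigO.of_bound 1 (Eventually.of_forall fun t => ?_)
    simp only [div_pow, norm_div, one_mul]
    exact div_le_self (norm_nonneg _) (by norm_num)
  have h3 := (h2.smul h1).congr_right (g₂ := fun h : ℝ => h ^ 3) fun h => by simp
  have h4 : (fun h : ℝ => h ^ 5) =O[𝓝[>] (0 : ℝ)] fun h : ℝ => h ^ 3 :=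
    (isLittleO_pow_pow (by norm_num : 3 < 5)).isBigO.mono nhdsWithin_le_nhds
  refine (((defect_step_sub_isBigO H h0 hγ).trans h4).add h3).congr_left fun h => ?_
  simp only [Function.comp_apply]
  abel

/-- A defect of order five at one initial value forces the coefficient of order three to
vanish there. -/
theorem defectCoeff_eq_zero_of_isBigO {γ : ℝ → E × E} (H : IsSymmetricForce V U G)
    (h0 : (γ 0).1 ∈ U) (hγ : ∀ᶠ t in 𝓝 (0 : ℝ), HasDerivAt γ (vectorField V (γ t)) t)
    (hO : (fun h : ℝ => γ h - γ 0 - h • stepMap V G h (γ 0) (γ h)) =O[𝓝[>] 0]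
      fun h : ℝ => h ^ 5) : defectCoeff V G (γ 0).1 (γ 0).2 = 0 := by
  have hhalf : Tendsto (fun h : ℝ => h / 2) (𝓝[>] 0) (𝓝 0) := by
    have : Continuous fun h : ℝ => h / 2 := by fun_prop
    exact (this.tendsto' 0 0 (by simp)).mono_left nhdsWithin_le_nhds
  have h5 : (fun h : ℝ => h ^ 5) =o[𝓝[>] (0 : ℝ)] fun h : ℝ => h ^ 3 :=
    (isLittleO_pow_pow (by norm_num : 3 < 5)).mono nhdsWithin_le_nhds
  -- The coefficient at the centre `h / 2` tends to the one at the initial state.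
  have h1 := (hO.sub (defect_step_sub_isBigO H h0 hγ)).trans_isLittleO h5
  have h2 := (tendsto_sub_nhds_zero_iff.2
    ((defect_isBigO H h0 hγ).2.tendsto.comp hhalf))
  have h3 := (isBigO_refl (fun h : ℝ => h ^ 3) (𝓝[>] 0)).smul_isLittleO
    ((isLittleO_one_iff ℝ).2 h2)
  have h4 : (fun h : ℝ => h ^ 3 • ((0 : E), defectCoeff V G (γ 0).1 (γ 0).2))
      =o[𝓝[>] 0] fun h : ℝ => h ^ 3 := by
    refine ((h1.const_smul_left (8 : ℝ)).sub
      (h3.congr_right fun h => by simp)).congr_left fun h => ?_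
    simp only [Pi.smul_apply, Function.comp_apply]
    module
  exact congrArg Prod.snd (eq_zero_of_pow_smul_isLittleO h4)

theorem defect_step_isBigO_pow_five {γ : ℝ → E × E} (H : IsSymmetricForce V U G)
    (h0 : (γ 0).1 ∈ U) (hγ : ∀ᶠ t in 𝓝 (0 : ℝ), HasDerivAt γ (vectorField V (γ t)) t)
    (hK : ∀ x ∈ U, ∀ p, defectCoeff V G x p = 0) :
    (fun h : ℝ => γ h - γ 0 - h • stepMap V G h (γ 0) (γ h)) =O[𝓝[>] 0] fun h : ℝ => h ^ 5 := by
  have hhalf : Tendsto (fun h : ℝ => h / 2) (𝓝[>] 0) (𝓝 0) := by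
    have : Continuous fun h : ℝ => h / 2 := by fun_prop
    exact (this.tendsto' 0 0 (by simp)).mono_left nhdsWithin_le_nhds
  refine (defect_step_sub_isBigO H h0 hγ).congr' ?_ EventuallyEq.rfl
  filter_upwards [(hγ.self_of_nhds.continuousAt.fst.tendsto.comp hhalf).eventually
    (H.isOpen.mem_nhds h0)] with h hh
  rw [hK (γ (h / 2)).1 hh]
  simp

theorem exists_hasDerivAt_vectorField (H : IsSymmetricForce V U G) {z : E × E} (hz : z.1 ∈ U) :
    ∃ γ : ℝ → E × E, γ 0 = z ∧ ∀ᶠ t in 𝓝 (0 : ℝ), HasDerivAt γ (vectorField V (γ t)) t := by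
  obtain ⟨γ, h0, ε, hε, h⟩ :=
    ((contDiffAt_vectorField (H.potential _ hz)).of_le (m := 1) (by simp)
      ).exists_forall_mem_closedBall_exists_eq_forall_mem_Ioo_hasDerivAt₀ 0
  exact ⟨γ, h0, Filter.eventually_of_mem (Ioo_mem_nhds (by linarith) (by linarith)) h⟩

end Order

section Space

variable {m : ℕ} {V : Space m → ℝ} {U : Set (Space m)} {G : Space m → Space m → Space m}

/-- The order of the scheme can be read off from the defect of the exact solutions. -/
theorem hasOrderAtLeast_iff (H : IsSymmetricForce V U G) (r : ℕ) :
    HasOrderAtLeast V U G r ↔ ∀ γ : ℝ → Space m × Space m, (γ 0).1 ∈ U →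
      (∀ᶠ t in 𝓝 (0 : ℝ), HasDerivAt γ (vectorField V (γ t)) t) →
        (fun h : ℝ => γ h - γ 0 - h • stepMap V G h (γ 0) (γ h)) =O[𝓝[>] 0]
          fun h : ℝ => h ^ (r + 1) := by
  have error_iff : ∀ {Z γ : ℝ → Space m × Space m}, (γ 0).1 ∈ U →
      (∀ᶠ t in 𝓝 (0 : ℝ), HasDerivAt γ (vectorField V (γ t)) t) →
      Tendsto Z (𝓝[>] 0) (𝓝 (γ 0)) →
      (∀ᶠ h in 𝓝[>] (0 : ℝ), Z h = γ 0 + h • stepMap V G h (γ 0) (Z h)) →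
      ((fun h => Z h - γ h) =O[𝓝[>] 0] (fun h : ℝ => h ^ (r + 1)) ↔
        (fun h : ℝ => γ h - γ 0 - h • stepMap V G h (γ 0) (γ h)) =O[𝓝[>] 0]
          fun h : ℝ => h ^ (r + 1)) := fun h0 hγ hZ heq =>
    error_isBigO_iff_defect_isBigO (contDiffAt_stepMap_right (H.potential _ h0) (H.smooth _ h0))
      hZ (hγ.self_of_nhds.continuousAt.tendsto.mono_left nhdsWithin_le_nhds) heq (r + 1)
  have eq_of_step : ∀ {x p : Space m} {X P : ℝ → Space m}, IsNumericalSolution V G x p X P →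
      ∀ᶠ h in 𝓝[>] (0 : ℝ), (X h, P h) = (x, p) + h • stepMap V G h (x, p) (X h, P h) :=
    fun hXP => hXP.2.2.mono fun h hh =>
      (isStep_iff (z := (_, _)) (z' := (_, _)) hh.1).1 hh
  have exists_num : ∀ z : Space m × Space m, z.1 ∈ U →
      ∃ X P : ℝ → Space m, IsNumericalSolution V G z.1 z.2 X P := by
    intro z hz
    obtain ⟨Z, hZ, hstep⟩ := exists_tendsto_step (z := z) (H.potential _ hz) (H.smooth _ hz)
    have hZ' : Tendsto Z (𝓝[>] 0) (𝓝 z) := hZ.mono_left nhdsWithin_le_nhds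
    exact ⟨fun h => (Z h).1, fun h => (Z h).2, hZ'.fst_nhds, hZ'.snd_nhds,
      hstep.mono fun h hh => (isStep_iff hh.1).2 hh.2⟩
  constructor
  · intro hr γ h0 hγ
    obtain ⟨X, P, hXP⟩ := exists_num (γ 0) h0
    have h1 := (hr _ h0 (γ 0).2).2 X P (fun t => (γ t).1) (fun t => (γ t).2) hXP
      ⟨rfl, rfl, hγ.mono fun t ht => ⟨ht.fst, ht.snd⟩⟩
    exact (error_iff (Z := fun h => (X h, P h)) h0 hγ (hXP.1.prodMk_nhds hXP.2.1)
      (eq_of_step hXP)).1 (h1.1.prod_left h1.2)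
  · intro hr x hx p
    refine ⟨exists_num (x, p) hx, fun X P ξ η hXP hξη => ?_⟩
    obtain ⟨rfl, rfl, hode⟩ := hξη
    have hγ : ∀ᶠ t in 𝓝 (0 : ℝ), HasDerivAt (fun t => (ξ t, η t))
        (vectorField V (ξ t, η t)) t := hode.mono fun t ht => ht.1.prodMk ht.2
    exact isBigO_prod_left.1 ((error_iff (Z := fun h => (X h, P h)) (γ := fun t => (ξ t, η t)) hx hγ
      (hXP.1.prodMk_nhds hXP.2.1) (eq_of_step hXP)).2 (hr _ hx hγ))

theorem hasOrderAtLeast_two (H : IsSymmetricForce V U G) : HasOrderAtLeast V U G 2 :=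
  (hasOrderAtLeast_iff H 2).2 fun _ h0 hγ => defect_step_isBigO_pow_three H h0 hγ

theorem hasOrderAtLeast_four_iff (H : IsSymmetricForce V U G) :
    HasOrderAtLeast V U G 4 ↔ ∀ x ∈ U, ∀ p, defectCoeff V G x p = 0 := by
  rw [hasOrderAtLeast_iff H]
  constructor
  · intro hr x hx p
    obtain ⟨γ, h0, hγ⟩ := exists_hasDerivAt_vectorField H (z := (x, p)) hx
    have hU : (γ 0).1 ∈ U := by rwa [h0]
    simpa [h0] using defectCoeff_eq_zero_of_isBigO H hU hγ (hr γ hU hγ)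
  · intro hK γ h0 hγ
    exact defect_step_isBigO_pow_five H h0 hγ hK

end Space

/-! ### The coefficients of the discrete gradient -/

section Coefficients

theorem fderiv_fderiv_clm_comp {E F F' : Type*} [NormedAddCommGroup E] [NormedSpace ℝ E]
    [NormedAddCommGroup F] [NormedSpace ℝ F] [NormedAddCommGroup F'] [NormedSpace ℝ F']
    (L : F →L[ℝ] F') {f : E → F} {x : E} (hf : ContDiffAt ℝ 2 f x) (u v : E) :
    fderiv ℝ (fderiv ℝ fun y => L (f y)) x u v = L (fderiv ℝ (fderiv ℝ f) x u v) := by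
  have h1 : fderiv ℝ (fun y => L (f y)) =ᶠ[𝓝 x] fun y => L ∘L fderiv ℝ f y := by
    filter_upwards [hf.eventually (by simp)] with y hy
    exact (L.hasFDerivAt.comp y (hy.differentiableAt (by simp)).hasFDerivAt).fderiv
  have h2 : DifferentiableAt ℝ (fderiv ℝ f) x :=
    (hf.fderiv_right (m := 1) (by norm_num)).differentiableAt (by simp)
  rw [h1.fderiv_eq, (hasFDerivAt_const L x).clm_comp h2.hasFDerivAt |>.fderiv]
  simp

/-- Polarization for the quadratic form of a symmetric matrix. -/
theorem eq_zero_of_sum_mul_mul_eq_zero {m : ℕ} {b : Fin m → Fin m → ℝ}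
    (hb : ∀ μ ν, b μ ν = b ν μ) (h : ∀ p : Space m, ∑ μ, ∑ ν, b μ ν * p μ * p ν = 0)
    (μ ν : Fin m) : b μ ν = 0 := by
  have hsingle : ∀ i j : Fin m, ∑ k, ∑ l, b k l * (EuclideanSpace.single i (1 : ℝ) : Space m) k *
      (EuclideanSpace.single j (1 : ℝ) : Space m) l = b i j := by
    intro i j
    simp
  have h1 := h (EuclideanSpace.single μ 1 + EuclideanSpace.single ν 1)
  simp only [PiLp.add_apply, mul_add, add_mul, Finset.sum_add_distrib, hsingle] at h1
  have h2 := h (EuclideanSpace.single μ 1)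
  have h3 := h (EuclideanSpace.single ν 1)
  rw [hsingle] at h2 h3
  linarith [hb μ ν]

variable {m : ℕ} {V : Space m → ℝ} {U : Set (Space m)} {G : Space m → Space m → Space m}

theorem gradient_apply (x : Space m) (γ : Fin m) : (∇ V) x γ = partialDeriv γ V x := by
  have h := InnerProductSpace.toDual_symm_apply (𝕜 := ℝ) (x := EuclideanSpace.single γ (1 : ℝ))
    (y := fderiv ℝ V x)
  rw [EuclideanSpace.inner_single_right] at h
  simpa [gradient, partialDeriv] using h

theorem contDiffAt_partialDeriv {x : Space m} (hV : ContDiffAt ℝ ∞ V x) (γ : Fin m) :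
    ContDiffAt ℝ ∞ (partialDeriv γ V) x :=
  (hV.fderiv_right (m := ∞) (by simp)).clm_apply contDiffAt_const

theorem partialDeriv_partialDeriv {f : Space m → ℝ} {x : Space m} (hf : ContDiffAt ℝ ∞ f x)
    (μ ν : Fin m) : partialDeriv ν (partialDeriv μ f) x =
      fderiv ℝ (fderiv ℝ f) x (EuclideanSpace.single ν 1) (EuclideanSpace.single μ 1) := by
  have h : DifferentiableAt ℝ (fderiv ℝ f) x :=
    (hf.fderiv_right (m := ∞) (by simp)).differentiableAt (by simp)
  change fderiv ℝ (fun y => fderiv ℝ f y (EuclideanSpace.single μ 1)) x _ = _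
  rw [(h.hasFDerivAt.clm_apply (hasFDerivAt_const (EuclideanSpace.single μ (1 : ℝ)) x)).fderiv]
  simp

theorem partialDeriv_comm {f : Space m → ℝ} {x : Space m} (hf : ContDiffAt ℝ ∞ f x)
    (μ ν : Fin m) :
    partialDeriv ν (partialDeriv μ f) x = partialDeriv μ (partialDeriv ν f) x := by
  have hsymm : IsSymmSndFDerivAt ℝ f x := hf.isSymmSndFDerivAt (by
    rw [minSmoothness_of_isRCLikeNormedField]; exact WithTop.coe_le_coe.2 le_top)
  rw [partialDeriv_partialDeriv hf, partialDeriv_partialDeriv hf, hsymm.eq]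

theorem fderiv_fderiv_apply_self {f : Space m → ℝ} {x : Space m} (hf : ContDiffAt ℝ ∞ f x)
    (p : Space m) : fderiv ℝ (fderiv ℝ f) x p p =
      ∑ μ, ∑ ν, partialDeriv ν (partialDeriv μ f) x * p μ * p ν := by
  have hp : p = ∑ μ, p μ • EuclideanSpace.single μ (1 : ℝ) := by
    ext i
    simp [Pi.single_apply]
  conv_lhs => rw [hp]
  simp only [map_sum, map_smul, sum_apply, smul_apply, partialDeriv_partialDeriv hf, smul_eq_mul,
    Finset.mul_sum]
  exact Finset.sum_congr rfl fun μ _ => Finset.sum_congr rfl fun ν _ => by ring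

theorem fderiv_fderiv_gradient_apply {x : Space m} (hV : ContDiffAt ℝ ∞ V x) (p : Space m)
    (γ : Fin m) : fderiv ℝ (fderiv ℝ (∇ V)) x p p γ =
      ∑ μ, ∑ ν, partialDeriv ν (partialDeriv μ (partialDeriv γ V)) x * p μ * p ν := by
  have hgrad2 := (contDiffAt_gradient hV).of_le (m := 2) (WithTop.coe_le_coe.2 le_top)
  have h := fderiv_fderiv_clm_comp (EuclideanSpace.proj γ : Space m →L[ℝ] ℝ) hgrad2 p p
  simp only [EuclideanSpace.coe_proj, gradient_apply] at h
  rw [← h]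
  exact fderiv_fderiv_apply_self (contDiffAt_partialDeriv hV γ) p

/-- The coefficients `B` of the expansion are three times the second derivatives of the discrete
gradient in its second argument, by uniqueness of expansions along lines. -/
theorem fderiv_fderiv_discreteGradient_apply {A : Space m → Fin m → Fin m → ℝ}
    {B : Space m → Fin m → Fin m → Fin m → ℝ} {C : Space m → Fin m → Fin m → Fin m → Fin m → ℝ}
    (hABC : HasExpansion V U G A B C) {x : Space m} (hx : x ∈ U)
    (hG : ContDiffAt ℝ ∞ (fun w : Space m × Space m => G w.1 w.2) (x, x))
    (hdiag : G x x = ∇ V x) (p : Space m) (γ : Fin m) :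
    fderiv ℝ (fderiv ℝ fun w : Space m × Space m => G w.1 w.2) (x, x) (0, p) (0, p) γ =
      1 / 3 * ∑ μ, ∑ ν, B x γ μ ν * p μ * p ν := by
  set Q := fderiv ℝ (fderiv ℝ fun w : Space m × Space m => G w.1 w.2) (x, x) (0, p) (0, p)
  set g := fderiv ℝ (fun w : Space m × Space m => G w.1 w.2) (x, x) (0, p)
  set a := ∑ μ, A x γ μ * p μ
  set b := ∑ μ, ∑ ν, B x γ μ ν * p μ * p ν with hb
  set c := ∑ μ, ∑ ν, ∑ σ, C x γ μ ν σ * p μ * p ν * p σ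
  have hline : Tendsto (fun s : ℝ => s • p) (𝓝 0) (𝓝 0) := by
    have : Continuous fun s : ℝ => s • p := by fun_prop
    exact this.tendsto' 0 0 (by simp)
  have h1 : (fun s : ℝ => G x (x + s • p) γ - ((∇ V) x γ + s * g γ + s ^ 2 / 2 * Q γ))
      =o[𝓝 0] fun s : ℝ => s ^ 2 := by
    have h := sub_taylor_two_line_isLittleO
      (hG.of_le (m := 2) (WithTop.coe_le_coe.2 le_top)) ((0 : Space m), p)
    refine (((EuclideanSpace.proj γ : Space m →L[ℝ] ℝ).isBigO_comp _ _).trans_isLittleO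
      h).congr_left fun s => ?_
    simp [hdiag, Q, g]
  have h2 : (fun s : ℝ => G x (x + s • p) γ -
      ((∇ V) x γ + s * (1 / 2 * a) + s ^ 2 * (1 / 6 * b) + s ^ 3 * (1 / 24 * c)))
        =o[𝓝 0] fun s : ℝ => s ^ 2 := by
    have h := (hABC.isBigO x hx γ).comp_tendsto hline
    have h3 : (fun s : ℝ => ‖s • p‖ ^ 4) =O[𝓝 0] fun s : ℝ => s ^ 4 := by
      refine IsBigO.of_bound (‖p‖ ^ 4) (Eventually.of_forall fun s => ?_)
      rw [norm_smul, mul_pow, norm_mul, norm_pow, norm_pow, norm_norm, norm_norm, norm_pow, mul_comm]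
    refine ((h.trans h3).trans_isLittleO (isLittleO_pow_pow (by norm_num : 2 < 4))).congr_left
      fun s => ?_
    simp only [Function.comp_apply, PiLp.smul_apply, smul_eq_mul, gradient_apply, a, b, c,
      Finset.mul_sum]
    congr 4
    · exact Finset.sum_congr rfl fun μ _ => by ring
    · exact funext fun μ => Finset.sum_congr rfl fun ν _ => by ring
    · exact funext fun μ => Finset.sum_congr rfl fun ν _ =>
        Finset.sum_congr rfl fun σ _ => by ring
  have h3 : (fun s : ℝ => s ^ 3 * (1 / 24 * c)) =o[𝓝 0] fun s : ℝ => s ^ 2 := by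
    refine IsBigO.trans_isLittleO (g := fun s : ℝ => s ^ 3)
      (IsBigO.of_bound ‖1 / 24 * c‖ (Eventually.of_forall fun s => ?_))
      (isLittleO_pow_pow (by norm_num : 2 < 3))
    rw [norm_mul, mul_comm]
  have h4 : (fun s : ℝ => s • (g γ - 1 / 2 * a) + s ^ 2 • (1 / 2 * Q γ - 1 / 6 * b))
      =o[𝓝 0] fun s : ℝ => s ^ 2 := by
    refine ((h2.sub h1).add h3).congr_left fun s => ?_
    simp only [smul_eq_mul]
    ring
  linarith [(eq_zero_of_smul_add_pow_smul_isLittleO (by norm_num) h4).2]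

theorem defectCoeff_apply {A : Space m → Fin m → Fin m → ℝ}
    {B : Space m → Fin m → Fin m → Fin m → ℝ} {C : Space m → Fin m → Fin m → Fin m → Fin m → ℝ}
    (hABC : HasExpansion V U G A B C) (H : IsSymmetricForce V U G) {x : Space m} (hx : x ∈ U)
    (p : Space m) (γ : Fin m) : defectCoeff V G x p γ = 4 / 3 * ∑ μ, ∑ ν,
      (B x γ μ ν - partialDeriv ν (partialDeriv μ (partialDeriv γ V)) x) * p μ * p ν := by
  simp only [defectCoeff, PiLp.smul_apply, PiLp.sub_apply, smul_eq_mul,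
    fderiv_fderiv_gradient_apply (H.potential x hx),
    fderiv_fderiv_discreteGradient_apply hABC hx (H.smooth x hx) (H.diag x hx),
    sub_mul, Finset.sum_sub_distrib]
  ring

theorem defectCoeff_eq_zero_iff {A : Space m → Fin m → Fin m → ℝ}
    {B : Space m → Fin m → Fin m → Fin m → ℝ} {C : Space m → Fin m → Fin m → Fin m → Fin m → ℝ}
    (hABC : HasExpansion V U G A B C) (H : IsSymmetricForce V U G) {x : Space m} (hx : x ∈ U) :
    (∀ p, defectCoeff V G x p = 0) ↔ ∀ γ μ ν : Fin m,
      B x γ μ ν = partialDeriv ν (partialDeriv μ (partialDeriv γ V)) x := by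
  constructor
  · intro h γ μ ν
    refine sub_eq_zero.1 (eq_zero_of_sum_mul_mul_eq_zero (b := fun μ ν => B x γ μ ν -
      partialDeriv ν (partialDeriv μ (partialDeriv γ V)) x) (fun μ ν => ?_) (fun p => ?_) μ ν)
    · rw [hABC.symm x hx γ μ ν,
        partialDeriv_comm (contDiffAt_partialDeriv (H.potential x hx) γ) μ ν]
    · have h1 := defectCoeff_apply hABC H hx p γ
      rw [h p] at h1
      simpa using h1.symm
  · intro h p
    ext γ
    rw [defectCoeff_apply hABC H hx]
    simp [h]

theorem IsDiscreteGradient.isSymmetricForce {D : Set (Space m × Space m)} (hU : IsOpen U)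
    (hV : ContDiffOn ℝ ∞ V U) (hD : IsOpen D) (hdiag : ∀ x ∈ U, (x, x) ∈ D)
    (hGsmooth : ContDiffOn ℝ ∞ (fun z : Space m × Space m => G z.1 z.2) D)
    (hG : IsDiscreteGradient V U D G) (hGsymm : IsSymmetricOn D G) : IsSymmetricForce V U G where
  isOpen := hU
  potential _ hx := hV.contDiffAt (hU.mem_nhds hx)
  smooth x hx := hGsmooth.contDiffAt (hD.mem_nhds (hdiag x hx))
  -- The limit defining consistency runs over a neighbourhood which contains `(x, x)` itself.
  diag x hx := tendsto_nhds_unique (tendsto_pure_nhds _ (x, x))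
    ((hG.tendsto x hx).mono_left (pure_le_nhds _))
  symm x hx := (hD.eventually_mem (hdiag x hx)).mono fun w hw => (hGsymm w.1 w.2 hw).2

end Coefficients

end SLEX

end

theorem theorem4p6 (m : ℕ) (U : Set (SLEX.Space m)) (hU : IsOpen U)
    (V : SLEX.Space m → ℝ) (hV : ContDiffOn ℝ ∞ V U)
    (D : Set (SLEX.Space m × SLEX.Space m)) (hD : IsOpen D)
    (hDU : D ⊆ U ×ˢ U) (hdiag : ∀ x ∈ U, (x, x) ∈ D)
    (G : SLEX.Space m → SLEX.Space m → SLEX.Space m)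
    (hGsmooth : ContDiffOn ℝ ∞ (fun z : SLEX.Space m × SLEX.Space m => G z.1 z.2) D)
    (hG : SLEX.IsDiscreteGradient V U D G)
    (hGsymm : SLEX.IsSymmetricOn D G)
    (A : SLEX.Space m → Fin m → Fin m → ℝ)
    (B : SLEX.Space m → Fin m → Fin m → Fin m → ℝ)
    (C : SLEX.Space m → Fin m → Fin m → Fin m → Fin m → ℝ)
    (hABC : SLEX.HasExpansion V U G A B C) :
    SLEX.HasOrderAtLeast V U G 2 ∧
    (SLEX.HasOrderAtLeast V U G 4 ↔
      ∀ x ∈ U, ∀ γ μ ν : Fin m, B x γ μ ν =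
        SLEX.partialDeriv ν (SLEX.partialDeriv μ (SLEX.partialDeriv γ V)) x) := by
  have H := hG.isSymmetricForce hU hV hD hdiag hGsmooth hGsymm
  refine ⟨SLEX.hasOrderAtLeast_two H, ?_⟩
  rw [SLEX.hasOrderAtLeast_four_iff H]
  exact forall₂_congr fun x hx => SLEX.defectCoeff_eq_zero_iff hABC H hx
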